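/- Let $m,n,r\in\mathbb N$ with $n\ge 1$, $1\le p<\infty$, $1/p+1/p'=1$ (so $1/p'=0$ for $p=1$, and $|x|^{0}=1$ for every $x$), $-\infty<a<b<\infty$ and $\varepsilon_0>0$. For $n\ge1$ let $W_p^n=W_p^n([a,b])$ be the Sobolev space of all $y\in C^{n-1}[a,b]$ with $y^{(n-1)}$ absolutely continuous and $y^{(n)}\in L_p[a,b]$, let $W_p^0=L_p$, and put $\|y\|_{n,p}=\sum_{k=0}^{n}\|y^{(k)}\|_p$. Write $(W_p^n)^m$ and $(W_p^n)^{m\times m}$ for the spaces of functions in this class with values in $\mathbb C^m$ and $\mathbb C^{m\times m}$. For $\varepsilon\in[0,\varepsilon_0)$ consider the problem $$y'(t,\varepsilon)+A(t,\varepsilon)y(t,\varepsilon)=f(t,\varepsilon),\quad t\in(a,b),$$ $$B(\varepsilon)y(\cdot,\varepsilon):=\sum_{j=0}^{r}\sum_{k=1}^{\omega_j(\varepsilon)}\sum_{l=0}^{n-1}\beta_{j,k}^{(l)}(\varepsilon)\,y^{(l)}(t_{j,k}(\varepsilon),\varepsilon)=q(\varepsilon),$$ where $A(\cdot,\varepsilon)\in(W_p^{n-1})^{m\times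 m}$, $f(\cdot,\varepsilon)\in(W_p^{n-1})^m$, $q(\varepsilon)\in\mathbb C^m$, $\omega_j(\varepsilon)\in\mathbb N$, $\beta_{j,k}^{(l)}(\varepsilon)\in\mathbb C^{m\times m}$ and $t_{j,k}(\varepsilon)\in[a,b]$ are arbitrary, and a solution is a function $y(\cdot,\varepsilon)\in(W_p^n)^m$ satisfying the differential equation almost everywhere on $(a,b)$ (everywhere if $n\ge2$) and the boundary condition. Let points $t_j\in[a,b]$ and matrices $\beta_j^{(l)}\in\mathbb C^{m\times m}$ ($1\le j\le r$, $0\le l\le n-1$) be given, and let the limiting boundary operator be $$B(0)y=\sum_{j=1}^{r}\sum_{l=0}^{n-1}\beta_j^{(l)}y^{(l)}(t_j),\qquad y\in(W_p^n)^m.$$ Assume that, as $\varepsilon\to0+$, $(\alpha)$ $t_{j,k}(\varepsilon)\to t_j$ for all $j\in\{1,\dots,r\}$, uniformly in $k\in\{1,\dots,\omega_j(\varepsilon)\}$; $(\beta)$ $\sum_{k=1}^{\omega_j(\varepsilon)}\beta_{j,k}^{(l)}(\varepsilon)\to\beta_j^{(l)}$ for all $j\in\{1,\dots,r\}$ and $l\in\{0,\dots,n-1\}$;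 $(\gamma_p)$ $\sum_{k=1}^{\omega_j(\varepsilon)}\|\beta_{j,k}^{(n-1)}(\varepsilon)\|\,|t_{j,k}(\varepsilon)-t_j|^{1/p'}=O(1)$ for all $j\in\{1,\dots,r\}$; $(\gamma')$ $\sum_{k=1}^{\omega_j(\varepsilon)}\|\beta_{j,k}^{(l)}(\varepsilon)\|\,|t_{j,k}(\varepsilon)-t_j|\to0$ for all $j\in\{1,\dots,r\}$ and all integers $l$ with $0\le l\le n-2$; $(\delta)$ $\sum_{k=1}^{\omega_0(\varepsilon)}\|\beta_{0,k}^{(l)}(\varepsilon)\|\to0$ for all $l\in\{0,\dots,n-1\}$. Then (II) $B(\varepsilon)y\to B(0)y$ in $\mathbb C^m$ as $\varepsilon\to0+$ for every $y\in(W_p^n)^m$. If, moreover, (0) the homogeneous problem $y'+A(\cdot,0)y=0$, $B(0)y=0$ has only the trivial solution in $(W_p^n)^m$, and (I) $A(\cdot,\varepsilon)\to A(\cdot,0)$ in $(W_p^{n-1})^{m\times m}$ as $\varepsilon\to0+$, then there is $\varepsilon_1\in(0,\varepsilon_0)$ such that for every $\varepsilon\in[0,\varepsilon_1)$ and arbitrary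 right-hand sides $f(\cdot,\varepsilon)\in(W_p^{n-1})^m$, $q(\varepsilon)\in\mathbb C^m$ the problem has a unique solution $y(\cdot,\varepsilon)\in(W_p^n)^m$; and whenever $f(\cdot,\varepsilon)\to f(\cdot,0)$ in $(W_p^{n-1})^m$ and $q(\varepsilon)\to q(0)$ in $\mathbb C^m$ as $\varepsilon\to0+$, these solutions satisfy $\|y(\cdot,\varepsilon)-y(\cdot,0)\|_{n,p}\to0$ as $\varepsilon\to0+$. -/

import Mathlib

open MeasureTheory Filter Topology Asymptotics
open scoped ENNReal Matrix Matrix.Norms.Operator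

/-- The Sobolev space `W_p^n([a,b]; E)` as a predicate on functions, only the values on `[a,b]`
being relevant. `W_p^0 = L_p`, and `y ∈ W_p^{n+1}` means `y ∈ C^n[a,b]`, `y^{(n)} ∈ AC[a,b]` and
`y^{(n+1)} ∈ L_p[a,b]`. -/
def MemSobolev {E : Type*} [NormedAddCommGroup E] [NormedSpace ℝ E]
    (n : ℕ) (p : ℝ≥0∞) (a b : ℝ) (y : ℝ → E) : Prop :=
  match n with
  | 0 => MemLp y p (volume.restrict (Set.Icc a b))
  | n + 1 =>
    ContDiffOn ℝ n y (Set.Icc a b) ∧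
    AbsolutelyContinuousOnInterval (iteratedDerivWithin n y (Set.Icc a b)) a b ∧
    MemLp (iteratedDerivWithin (n + 1) y (Set.Icc a b)) p (volume.restrict (Set.Icc a b))

/-- The norm `‖y‖_{n,p} = ∑_{k=0}^{n-1} ‖y^{(k)}‖_p + ‖y^{(n)}‖_p`, with values in `[0,∞]`. -/
noncomputable def sobolevNorm {E : Type*} [NormedAddCommGroup E] [NormedSpace ℝ E]
    (n : ℕ) (p : ℝ≥0∞) (a b : ℝ) (y : ℝ → E) : ℝ≥0∞ :=
  ∑ k ∈ Finset.range n,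
      eLpNorm (iteratedDerivWithin k y (Set.Icc a b)) p (volume.restrict (Set.Icc a b)) +
    eLpNorm (iteratedDerivWithin n y (Set.Icc a b)) p (volume.restrict (Set.Icc a b))

/-- `y ∈ (W_p^n)^m` solves `y' + A y = f` on `(a,b)`, almost everywhere (everywhere if `n ≥ 2`),
together with the boundary condition `B y = c`. -/
def IsBVPSolution {m : ℕ} (n : ℕ) (p : ℝ≥0∞) (a b : ℝ)
    (A : ℝ → Matrix (Fin m) (Fin m) ℂ) (f : ℝ → Fin m → ℂ)
    (B : (ℝ → Fin m → ℂ) → Fin m → ℂ) (c : Fin m → ℂ) (y : ℝ → Fin m → ℂ) : Prop :=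
  MemSobolev n p a b y ∧
  (∀ᵐ t ∂(volume.restrict (Set.Ioo a b)),
    derivWithin y (Set.Icc a b) t + A t *ᵥ y t = f t) ∧
  (2 ≤ n → ∀ t ∈ Set.Ioo a b, derivWithin y (Set.Icc a b) t + A t *ᵥ y t = f t) ∧
  B y = c

/-- The multipoint boundary operator
`B(ε) y = ∑_{j=0}^r ∑_{k=1}^{ω_j(ε)} ∑_{l=0}^{n-1} β_{j,k}^{(l)}(ε) y^{(l)}(t_{j,k}(ε))`;
here `β j k l ε` stands for `β_{j,k}^{(l)}(ε)` and `t j k ε` for `t_{j,k}(ε)`. -/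
noncomputable def multipointOp {m : ℕ} (n r : ℕ) (a b : ℝ) (ω : ℕ → ℝ → ℕ)
    (β : ℕ → ℕ → ℕ → ℝ → Matrix (Fin m) (Fin m) ℂ) (t : ℕ → ℕ → ℝ → ℝ)
    (ε : ℝ) (y : ℝ → Fin m → ℂ) : Fin m → ℂ :=
  ∑ j ∈ Finset.range (r + 1), ∑ k ∈ Finset.Icc 1 (ω j ε), ∑ l ∈ Finset.range n,
    β j k l ε *ᵥ iteratedDerivWithin l y (Set.Icc a b) (t j k ε)

/-- The limiting operator `y ↦ ∑_{j=1}^r ∑_{l=0}^{n-1} β_j^{(l)} y^{(l)}(t_j)`. -/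
noncomputable def limitMultipointOp {m : ℕ} (n r : ℕ) (a b : ℝ)
    (β₀ : ℕ → ℕ → Matrix (Fin m) (Fin m) ℂ) (t₀ : ℕ → ℝ)
    (y : ℝ → Fin m → ℂ) : Fin m → ℂ :=
  ∑ j ∈ Finset.Icc 1 r, ∑ l ∈ Finset.range n,
    β₀ j l *ᵥ iteratedDerivWithin l y (Set.Icc a b) (t₀ j)

/-- Assumption (α): `t_{j,k}(ε) → t_j` as `ε → 0+`, for `1 ≤ j ≤ r`, uniformly in
`1 ≤ k ≤ ω_j(ε)`. -/
def CondAlpha (r : ℕ) (ω : ℕ → ℝ → ℕ) (t : ℕ → ℕ → ℝ → ℝ) (t₀ : ℕ → ℝ) : Prop :=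
  ∀ j ∈ Finset.Icc 1 r, ∀ η > 0, ∀ᶠ ε in 𝓝[>] (0 : ℝ),
    ∀ k ∈ Finset.Icc 1 (ω j ε), |t j k ε - t₀ j| < η

/-- Assumption (β): `∑_k β_{j,k}^{(l)}(ε) → β_j^{(l)}` for `1 ≤ j ≤ r` and `0 ≤ l ≤ n - 1`. -/
def CondBeta {m : ℕ} (n r : ℕ) (ω : ℕ → ℝ → ℕ)
    (β : ℕ → ℕ → ℕ → ℝ → Matrix (Fin m) (Fin m) ℂ)
    (β₀ : ℕ → ℕ → Matrix (Fin m) (Fin m) ℂ) : Prop :=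
  ∀ j ∈ Finset.Icc 1 r, ∀ l ∈ Finset.range n,
    Tendsto (fun ε => ∑ k ∈ Finset.Icc 1 (ω j ε), β j k l ε) (𝓝[>] (0 : ℝ)) (𝓝 (β₀ j l))

/-- Assumption (γ_p): `∑_k ‖β_{j,k}^{(n-1)}(ε)‖ |t_{j,k}(ε) - t_j|^{1/p'} = O(1)` for
`1 ≤ j ≤ r`, where `1/p' = 1 - 1/p` (so the power is `1` if `p = 1`). -/
def CondGammaP {m : ℕ} (n r : ℕ) (p : ℝ≥0∞) (ω : ℕ → ℝ → ℕ)
    (β : ℕ → ℕ → ℕ → ℝ → Matrix (Fin m) (Fin m) ℂ)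
    (t : ℕ → ℕ → ℝ → ℝ) (t₀ : ℕ → ℝ) : Prop :=
  ∀ j ∈ Finset.Icc 1 r,
    (fun ε => ∑ k ∈ Finset.Icc 1 (ω j ε),
        ‖β j k (n - 1) ε‖ * |t j k ε - t₀ j| ^ (1 - 1 / p.toReal))
      =O[𝓝[>] (0 : ℝ)] (fun _ => (1 : ℝ))

/-- Assumption (γ'): `∑_k ‖β_{j,k}^{(l)}(ε)‖ |t_{j,k}(ε) - t_j| → 0` for `1 ≤ j ≤ r` and
`0 ≤ l ≤ n - 2`. -/
def CondGamma' {m : ℕ} (n r : ℕ) (ω : ℕ → ℝ → ℕ)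
    (β : ℕ → ℕ → ℕ → ℝ → Matrix (Fin m) (Fin m) ℂ)
    (t : ℕ → ℕ → ℝ → ℝ) (t₀ : ℕ → ℝ) : Prop :=
  ∀ j ∈ Finset.Icc 1 r, ∀ l ∈ Finset.range (n - 1),
    Tendsto (fun ε => ∑ k ∈ Finset.Icc 1 (ω j ε), ‖β j k l ε‖ * |t j k ε - t₀ j|)
      (𝓝[>] (0 : ℝ)) (𝓝 0)

/-- Assumption (δ): `∑_k ‖β_{0,k}^{(l)}(ε)‖ → 0` for `0 ≤ l ≤ n - 1`. -/
def CondDelta {m : ℕ} (n : ℕ) (ω : ℕ → ℝ → ℕ)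
    (β : ℕ → ℕ → ℕ → ℝ → Matrix (Fin m) (Fin m) ℂ) : Prop :=
  ∀ l ∈ Finset.range n,
    Tendsto (fun ε => ∑ k ∈ Finset.Icc 1 (ω 0 ε), ‖β 0 k l ε‖) (𝓝[>] (0 : ℝ)) (𝓝 0)

/-- Condition (0): the limiting homogeneous problem `y' + A(0) y = 0`, `B(0) y = 0` has only the
trivial solution. -/
def CondZero {m : ℕ} (n : ℕ) (p : ℝ≥0∞) (a b : ℝ)
    (A : ℝ → ℝ → Matrix (Fin m) (Fin m) ℂ)
    (B : ℝ → (ℝ → Fin m → ℂ) → Fin m → ℂ) : Prop :=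
  ∀ y : ℝ → Fin m → ℂ, IsBVPSolution n p a b (A 0) 0 (B 0) 0 y → Set.EqOn y 0 (Set.Icc a b)

/-- Condition (I): `A(·,ε) → A(·,0)` in `(W_p^{n-1})^{m×m}` as `ε → 0+`; `A ε` is `A(·,ε)`. -/
def CondI {m : ℕ} (n : ℕ) (p : ℝ≥0∞) (a b : ℝ)
    (A : ℝ → ℝ → Matrix (Fin m) (Fin m) ℂ) : Prop :=
  Tendsto (fun ε => sobolevNorm (n - 1) p a b (A ε - A 0)) (𝓝[>] (0 : ℝ)) (𝓝 0)

/-- Condition (II): `B(ε) y → B(0) y` in `ℂ^m` as `ε → 0+`, for every `y ∈ (W_p^n)^m`. -/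
def CondII {m : ℕ} (n : ℕ) (p : ℝ≥0∞) (a b : ℝ)
    (B : ℝ → (ℝ → Fin m → ℂ) → Fin m → ℂ) : Prop :=
  ∀ y : ℝ → Fin m → ℂ, MemSobolev n p a b y →
    Tendsto (fun ε => B ε y) (𝓝[>] (0 : ℝ)) (𝓝 (B 0 y))

/-- The solution depends continuously on the parameter at `ε = 0`: for small `ε` and arbitrary
right-hand sides the problem has exactly one solution, and the convergence of the right-hand sides
`f(·,ε) → f(·,0)` in `(W_p^{n-1})^m` and `c(ε) → c(0)` in `ℂ^m` as `ε → 0+` implies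
`‖y(·,ε) - y(·,0)‖_{n,p} → 0`. -/
def SolutionContinuousAtZero {m : ℕ} (n : ℕ) (p : ℝ≥0∞) (a b ε₀ : ℝ)
    (A : ℝ → ℝ → Matrix (Fin m) (Fin m) ℂ)
    (B : ℝ → (ℝ → Fin m → ℂ) → Fin m → ℂ) : Prop :=
  ∃ ε₁ : ℝ, 0 < ε₁ ∧ ε₁ < ε₀ ∧
    (∀ ε ∈ Set.Ico 0 ε₁, ∀ (f : ℝ → Fin m → ℂ) (c : Fin m → ℂ),
      MemSobolev (n - 1) p a b f →
      ∃ y : ℝ → Fin m → ℂ, IsBVPSolution n p a b (A ε) f (B ε) c y ∧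
        ∀ z : ℝ → Fin m → ℂ, IsBVPSolution n p a b (A ε) f (B ε) c z →
          Set.EqOn z y (Set.Icc a b)) ∧
    (∀ (f : ℝ → ℝ → Fin m → ℂ) (c : ℝ → Fin m → ℂ),
      (∀ ε ∈ Set.Ico 0 ε₀, MemSobolev (n - 1) p a b (f ε)) →
      Tendsto (fun ε => sobolevNorm (n - 1) p a b (f ε - f 0)) (𝓝[>] (0 : ℝ)) (𝓝 0) →
      Tendsto c (𝓝[>] (0 : ℝ)) (𝓝 (c 0)) →
      ∀ y : ℝ → ℝ → Fin m → ℂ,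
        (∀ ε ∈ Set.Ico 0 ε₁, IsBVPSolution n p a b (A ε) (f ε) (B ε) (c ε) (y ε)) →
        Tendsto (fun ε => sobolevNorm n p a b (y ε - y 0)) (𝓝[>] (0 : ℝ)) (𝓝 0))

/-! The proof reduces the boundary value problem to finite-dimensional linear algebra over the
initial value problem. Let `Y ε` be the fundamental system normalised at `a`, and let `u ε` be the
particular solution vanishing at `a`. Every solution is `u ε` plus a combination of `Y ε` with
coefficients `y ε a`, so the boundary condition becomes `M(ε) y(a) = c(ε) - B(ε) u(ε)` for the
characteristic matrix `M(ε)`. Condition (0) says that `M(0)` is invertible. If `M(ε) → M(0)` and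
`B(ε) u(ε) → B(0) u(0)`, then `M(ε)` is invertible for small `ε`, the initial values converge, and
the solutions converge with them.

Two facts carry this. The first is `tendsto_sobolevNorm_sub_of_isODESolution`: solutions of the
initial value problem depend continuously on the data in the full Sobolev norm. A weighted Volterra
estimate gives uniform smallness of differences, and the equation with a product estimate then
raises the order one derivative at a time.

The second is `tendsto_multipointOp`: `B(ε) Y(ε) → B(0) Y(0)` whenever `Y(ε) → Y(0)` in the Sobolev
norm. Constant families give (II), and varying families give the convergence of `M(ε)` and `B(ε)
u(ε)` directly. For the lower derivatives a uniform Lipschitz bound meets (γ'). For the highest one,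
(γ_p) gives only boundedness. The missing smallness comes from Hölder's inequality, `|v(t) - v(s)| ≤
‖v'‖_{L_p[s,t]} |t - s|^{1/p'}`, whose first factor vanishes on short intervals because `p < ∞`. -/

namespace AbsolutelyContinuousOnInterval

lemma of_dist_le {X Y : Type*} [PseudoMetricSpace X] [PseudoMetricSpace Y] {f : ℝ → X}
    {Φ : ℝ → Y} {a b : ℝ} (hΦ : AbsolutelyContinuousOnInterval Φ a b)
    (h : ∀ s ∈ Set.uIcc a b, ∀ t ∈ Set.uIcc a b, dist (f s) (f t) ≤ dist (Φ s) (Φ t)) :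
    AbsolutelyContinuousOnInterval f a b := by
  rw [absolutelyContinuousOnInterval_iff] at hΦ ⊢
  intro ε hε
  obtain ⟨δ, hδ, H⟩ := hΦ ε hε
  refine ⟨δ, hδ, fun E hE hlen => lt_of_le_of_lt (Finset.sum_le_sum fun i hi => ?_) (H E hE hlen)⟩
  exact h _ (hE.1 i hi).1 _ (hE.1 i hi).2

lemma congr_eqOn {X : Type*} [PseudoMetricSpace X] {f f' : ℝ → X} {a b : ℝ}
    (hf : AbsolutelyContinuousOnInterval f a b) (h : Set.EqOn f f' (Set.uIcc a b)) :
    AbsolutelyContinuousOnInterval f' a b :=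
  hf.of_dist_le fun s hs t ht => by rw [h hs, h ht]

end AbsolutelyContinuousOnInterval

/-! ### Lebesgue primitives and the product rule -/

section Primitive

variable {E F G : Type*} [NormedAddCommGroup E] [NormedSpace ℝ E]
  [NormedAddCommGroup F] [NormedSpace ℝ F] [NormedAddCommGroup G] [NormedSpace ℝ G]

/-- On `[a,b]`, the function `y` is a Lebesgue primitive of the integrable function `g`. -/
structure IsPrimitive (a b : ℝ) (y g : ℝ → E) : Prop where
  integrableOn : IntegrableOn g (Set.Icc a b)
  eq_add : ∀ t ∈ Set.Icc a b, y t = y a + ∫ s in a..t, g s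

omit [NormedSpace ℝ E] in
lemma MeasureTheory.IntegrableOn.intervalIntegrable_of_mem {g : ℝ → E} {a b s t : ℝ}
    (hg : IntegrableOn g (Set.Icc a b)) (hs : s ∈ Set.Icc a b) (ht : t ∈ Set.Icc a b) :
    IntervalIntegrable g volume s t :=
  (hg.mono_set (Set.uIcc_subset_Icc hs ht)).intervalIntegrable

lemma setIntegral_Icc_eq_intervalIntegral {a b : ℝ} (hab : a ≤ b) (g : ℝ → E) :
    ∫ s in Set.Icc a b, g s = ∫ s in a..b, g s := by
  rw [intervalIntegral.integral_of_le hab, integral_Icc_eq_integral_Ioc]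

lemma ae_restrict_Icc_mem_Ioo (a b : ℝ) :
    ∀ᵐ t ∂(volume.restrict (Set.Icc a b)), t ∈ Set.Ioo a b := by
  rw [← Measure.restrict_congr_set (Ioo_ae_eq_Icc (μ := volume) (a := a) (b := b))]
  exact ae_restrict_mem measurableSet_Ioo

namespace IsPrimitive

variable {a b : ℝ} {y g y' g' : ℝ → E}

lemma of_eq_const_add (hab : a ≤ b) {c : E} (hg : IntegrableOn g (Set.Icc a b))
    (h : ∀ t ∈ Set.Icc a b, y t = c + ∫ s in a..t, g s) : IsPrimitive a b y g := by
  have hc : y a = c := by simpa using h a ⟨le_rfl, hab⟩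
  exact ⟨hg, by rwa [hc]⟩

lemma sub_eq (h : IsPrimitive a b y g) {s t : ℝ} (hs : s ∈ Set.Icc a b) (ht : t ∈ Set.Icc a b) :
    y t - y s = ∫ u in s..t, g u := by
  have ha : a ∈ Set.Icc a b := ⟨le_rfl, hs.1.trans hs.2⟩
  rw [h.eq_add t ht, h.eq_add s hs, add_sub_add_left_eq_sub,
    intervalIntegral.integral_interval_sub_left (h.integrableOn.intervalIntegrable_of_mem ha ht)
      (h.integrableOn.intervalIntegrable_of_mem ha hs)]

lemma congr (h : IsPrimitive a b y g) (hy : Set.EqOn y y' (Set.Icc a b))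
    (hg : g =ᵐ[volume.restrict (Set.Icc a b)] g') : IsPrimitive a b y' g' := by
  refine ⟨h.integrableOn.congr hg, fun t ht => ?_⟩
  have ha : a ∈ Set.Icc a b := ⟨le_rfl, ht.1.trans ht.2⟩
  rw [← hy ht, ← hy ha, h.eq_add t ht]
  congr 1
  rw [intervalIntegral.integral_of_le ht.1, intervalIntegral.integral_of_le ht.1]
  exact integral_congr_ae (ae_restrict_of_ae_restrict_of_subset
    (Set.Ioc_subset_Icc_self.trans (Set.Icc_subset_Icc_right ht.2)) hg)

/-- The increments of `y` are dominated by those of the scalar function `t ↦ ∫ ‖g‖` from `a` to `t`,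
so the real-valued result suffices. -/
lemma absolutelyContinuousOnInterval (hab : a ≤ b) (h : IsPrimitive a b y g) :
    AbsolutelyContinuousOnInterval y a b := by
  have ha : a ∈ Set.Icc a b := ⟨le_rfl, hab⟩
  have hn : IntegrableOn (fun s => ‖g s‖) (Set.Icc a b) := h.integrableOn.norm
  have hΦ := (hn.intervalIntegrable_of_mem ha
    ⟨hab, le_rfl⟩).absolutelyContinuousOnInterval_intervalIntegral (c := a) Set.left_mem_uIcc
  refine hΦ.of_dist_le fun s hs t ht => ?_
  rw [Set.uIcc_of_le hab] at hs ht
  rw [dist_eq_norm, h.sub_eq ht hs, Real.dist_eq,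
    intervalIntegral.integral_interval_sub_left (hn.intervalIntegrable_of_mem ha hs)
      (hn.intervalIntegrable_of_mem ha ht)]
  exact intervalIntegral.norm_integral_le_abs_integral_norm

lemma continuousOn (hab : a ≤ b) (h : IsPrimitive a b y g) : ContinuousOn y (Set.Icc a b) := by
  simpa [Set.uIcc_of_le hab] using (h.absolutelyContinuousOnInterval hab).continuousOn

lemma ae_hasDerivAt [CompleteSpace E] (hab : a ≤ b) (h : IsPrimitive a b y g) :
    ∀ᵐ t ∂(volume.restrict (Set.Icc a b)), HasDerivAt y (g t) t := by
  have ha : a ∈ Set.Icc a b := ⟨le_rfl, hab⟩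
  have H := (h.integrableOn.intervalIntegrable_of_mem ha ⟨hab, le_rfl⟩).ae_hasDerivAt_integral
  rw [Set.uIcc_of_le hab] at H
  filter_upwards [ae_restrict_Icc_mem_Ioo a b, ae_restrict_of_ae H] with t ht hd
  have h1 := (hd (Set.Ioo_subset_Icc_self ht) a ha).const_add (y a)
  refine h1.congr_of_eventuallyEq ?_
  filter_upwards [Ioo_mem_nhds ht.1 ht.2] with u hu using h.eq_add u (Set.Ioo_subset_Icc_self hu)

lemma ae_derivWithin_eq [CompleteSpace E] (hab : a < b) (h : IsPrimitive a b y g) :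
    derivWithin y (Set.Icc a b) =ᵐ[volume.restrict (Set.Icc a b)] g := by
  filter_upwards [h.ae_hasDerivAt hab.le, ae_restrict_mem measurableSet_Icc] with t ht htm
  exact ht.hasDerivWithinAt.derivWithin (uniqueDiffOn_Icc hab t htm)

lemma hasDerivWithinAt [CompleteSpace E] (hab : a ≤ b) (h : IsPrimitive a b y g)
    (hg : ContinuousOn g (Set.Icc a b)) {t : ℝ} (ht : t ∈ Set.Icc a b) :
    HasDerivWithinAt y (g t) (Set.Icc a b) t := by
  -- Extending `g` by constants beyond the endpoints makes the fundamental theorem of calculus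
  -- available at `a` and `b` as well.
  have hc : Continuous (Set.IccExtend hab ((Set.Icc a b).domRestrict g)) :=
    (continuousOn_iff_continuous_domRestrict.mp hg).Icc_extend'
  have key : ∀ u ∈ Set.Icc a b, Set.IccExtend hab ((Set.Icc a b).domRestrict g) u = g u :=
    fun u hu => by rw [Set.IccExtend_of_mem hab _ hu]; rfl
  have h1 := ((hc.integral_hasStrictDerivAt a t).hasDerivAt.const_add (y a)).hasDerivWithinAt
    (s := Set.Icc a b)
  rw [key t ht] at h1
  refine h1.congr_of_mem (fun u hu => ?_) ht
  rw [h.eq_add u hu]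
  congr 1
  refine intervalIntegral.integral_congr fun v hv => (key v ?_).symm
  rw [Set.uIcc_of_le hu.1] at hv
  exact ⟨hv.1, hv.2.trans hu.2⟩

lemma derivWithin_eqOn [CompleteSpace E] (hab : a < b) (h : IsPrimitive a b y g)
    (hg : ContinuousOn g (Set.Icc a b)) :
    Set.EqOn (derivWithin y (Set.Icc a b)) g (Set.Icc a b) := fun t ht =>
  (h.hasDerivWithinAt hab.le hg ht).derivWithin (uniqueDiffOn_Icc hab t ht)

/-- Subtracting the integral of `g` leaves an absolutely continuous function with zero derivative
almost everywhere, hence a constant. -/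
lemma of_ac_of_ae_hasDerivAt [CompleteSpace E] (hab : a ≤ b)
    (hy : AbsolutelyContinuousOnInterval y a b)
    (hd : ∀ᵐ t ∂(volume.restrict (Set.Icc a b)), HasDerivAt y (g t) t)
    (hg : IntegrableOn g (Set.Icc a b)) : IsPrimitive a b y g := by
  have hP : IsPrimitive a b (fun t => ∫ s in a..t, g s) g :=
    of_eq_const_add hab (c := 0) hg fun t _ => by simp
  have hac := hy.sub (hP.absolutelyContinuousOnInterval hab)
  have h0 : ∀ᵐ t, t ∈ Set.uIcc a b → HasDerivAt (y - fun t => ∫ s in a..t, g s) 0 t := by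
    rw [Set.uIcc_of_le hab, ← ae_restrict_iff' measurableSet_Icc]
    filter_upwards [hd, hP.ae_hasDerivAt hab] with t h1 h2
    simpa using h1.sub h2
  obtain ⟨C, hC⟩ := hac.const_of_ae_hasDerivAt_zero h0
  rw [Set.uIcc_of_le hab] at hC
  refine of_eq_const_add hab (c := C) hg fun t ht => ?_
  rw [← hC t ht]; simp

/-- Absolute continuity gives bounded variation, and in finite dimension this gives
differentiability almost everywhere. -/
lemma of_ac_derivWithin [FiniteDimensional ℝ E] (hab : a < b)
    (hy : AbsolutelyContinuousOnInterval y a b)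
    (hg : IntegrableOn (derivWithin y (Set.Icc a b)) (Set.Icc a b)) :
    IsPrimitive a b y (derivWithin y (Set.Icc a b)) := by
  have := FiniteDimensional.complete ℝ E
  refine of_ac_of_ae_hasDerivAt hab.le hy ?_ hg
  have h := hy.boundedVariationOn.ae_differentiableAt_of_mem_uIcc
  rw [Set.uIcc_of_le hab.le, ← ae_restrict_iff' measurableSet_Icc] at h
  filter_upwards [h, ae_restrict_Icc_mem_Ioo a b] with t h1 ht
  rw [derivWithin_of_mem_nhds (Icc_mem_nhds ht.1 ht.2)]
  exact h1.hasDerivAt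

lemma add (h : IsPrimitive a b y g) (h' : IsPrimitive a b y' g') :
    IsPrimitive a b (y + y') (g + g') := by
  refine ⟨h.integrableOn.add h'.integrableOn, fun t ht => ?_⟩
  have ha : a ∈ Set.Icc a b := ⟨le_rfl, ht.1.trans ht.2⟩
  simp only [Pi.add_apply]
  rw [intervalIntegral.integral_add (h.integrableOn.intervalIntegrable_of_mem ha ht)
    (h'.integrableOn.intervalIntegrable_of_mem ha ht), h.eq_add t ht, h'.eq_add t ht]
  abel

lemma clm [CompleteSpace E] [CompleteSpace F] (h : IsPrimitive a b y g) (T : E →L[ℝ] F) :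
    IsPrimitive a b (fun t => T (y t)) (fun t => T (g t)) := by
  refine ⟨T.integrable_comp h.integrableOn, fun t ht => ?_⟩
  have ha : a ∈ Set.Icc a b := ⟨le_rfl, ht.1.trans ht.2⟩
  rw [T.intervalIntegral_comp_comm (h.integrableOn.intervalIntegrable_of_mem ha ht),
    h.eq_add t ht, map_add]

/-- The product rule for primitives. -/
lemma bilin [CompleteSpace E] [CompleteSpace F] [CompleteSpace G] (hab : a ≤ b)
    (L : E →L[ℝ] F →L[ℝ] G) {z w : ℝ → F} (h : IsPrimitive a b y g) (h' : IsPrimitive a b z w) :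
    IsPrimitive a b (fun t => L (y t) (z t)) (fun t => L (y t) (w t) + L (g t) (z t)) := by
  have hy := h.continuousOn hab
  have hz := h'.continuousOn hab
  obtain ⟨K, hK⟩ := isCompact_Icc.exists_bound_of_continuousOn hy
  obtain ⟨M, hM⟩ := isCompact_Icc.exists_bound_of_continuousOn hz
  have ha : a ∈ Set.Icc a b := ⟨le_rfl, hab⟩
  have hK0 : 0 ≤ K := (norm_nonneg _).trans (hK a ha)
  have hM0 : 0 ≤ M := (norm_nonneg _).trans (hM a ha)
  have hint1 : IntegrableOn (fun t => L (y t) (w t)) (Set.Icc a b) := by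
    refine Integrable.mono' (h'.integrableOn.norm.const_mul (‖L‖ * K)) ?_ ?_
    · exact L.aestronglyMeasurable_comp₂ (hy.aestronglyMeasurable measurableSet_Icc)
        h'.integrableOn.aestronglyMeasurable
    · filter_upwards [ae_restrict_mem measurableSet_Icc] with t ht
      refine (L.le_opNorm₂ _ _).trans ?_
      gcongr
      exact hK t ht
  have hint2 : IntegrableOn (fun t => L (g t) (z t)) (Set.Icc a b) := by
    refine Integrable.mono' (h.integrableOn.norm.const_mul (‖L‖ * M)) ?_ ?_
    · exact L.aestronglyMeasurable_comp₂ h.integrableOn.aestronglyMeasurable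
        (hz.aestronglyMeasurable measurableSet_Icc)
    · filter_upwards [ae_restrict_mem measurableSet_Icc] with t ht
      refine (L.le_opNorm₂ _ _).trans ?_
      calc ‖L‖ * ‖g t‖ * ‖z t‖ ≤ ‖L‖ * ‖g t‖ * M := by gcongr; exact hM t ht
        _ = ‖L‖ * M * ‖g t‖ := by ring
  refine of_ac_of_ae_hasDerivAt hab ?_ ?_ (hint1.add hint2)
  · have h1 := (h.absolutelyContinuousOnInterval hab)
    have h2 := (h'.absolutelyContinuousOnInterval hab)
    -- Absolute continuity is by definition the vanishing of a limit of sums of increments, so the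
    -- two moduli can be combined as limits; the increment of the product is split below as `L (y s
    -- - y t) (z s) + L (y t) (z s - z t)`.
    have h3 : Tendsto _ _ _ := (Tendsto.const_mul (‖L‖ * M) h1).add (Tendsto.const_mul (‖L‖ * K) h2)
    simp only [mul_zero, add_zero] at h3
    refine squeeze_zero' (Eventually.of_forall fun E => Finset.sum_nonneg fun _ _ => dist_nonneg)
      ?_ h3
    filter_upwards [mem_inf_of_right (mem_principal_self _)] with E hE
    rw [Finset.mul_sum, Finset.mul_sum, ← Finset.sum_add_distrib]
    refine Finset.sum_le_sum fun i hi => ?_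
    obtain ⟨hs, ht⟩ := hE.1 i hi
    rw [Set.uIcc_of_le hab] at hs ht
    generalize (E.2 i).1 = s at *
    generalize (E.2 i).2 = t at *
    have e : L (y s) (z s) - L (y t) (z t) = L (y s - y t) (z s) + L (y t) (z s - z t) := by
      simp
    rw [dist_eq_norm, dist_eq_norm, dist_eq_norm, e]
    refine (norm_add_le _ _).trans (add_le_add ?_ ?_)
    · refine (L.le_opNorm₂ _ _).trans ?_
      calc ‖L‖ * ‖y s - y t‖ * ‖z s‖ ≤ ‖L‖ * ‖y s - y t‖ * M := by gcongr; exact hM s hs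
        _ = _ := by ring
    · refine (L.le_opNorm₂ _ _).trans ?_
      gcongr
      exact hK t ht
  · filter_upwards [h.ae_hasDerivAt hab, h'.ae_hasDerivAt hab] with t h1 h2
    exact L.hasDerivAt_of_bilinear (fun _ => h1) (fun _ => h2)

end IsPrimitive

end Primitive

/-! ### Sobolev spaces as iterated primitives -/

section Sobolev

variable {E F G : Type*} [NormedAddCommGroup E] [NormedSpace ℝ E]
  [NormedAddCommGroup F] [NormedSpace ℝ F] [NormedAddCommGroup G] [NormedSpace ℝ G]
  {a b : ℝ} {p : ℝ≥0∞} {n k : ℕ} {y z g g' : ℝ → E}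

lemma sobolevNorm_zero : sobolevNorm 0 p a b y = eLpNorm y p (volume.restrict (Set.Icc a b)) := by
  simp [sobolevNorm]

lemma sobolevNorm_eq_sum : sobolevNorm n p a b y = ∑ k ∈ Finset.range (n + 1),
    eLpNorm (iteratedDerivWithin k y (Set.Icc a b)) p (volume.restrict (Set.Icc a b)) := by
  rw [Finset.sum_range_succ, sobolevNorm]

lemma sobolevNorm_succ_derivWithin : sobolevNorm (n + 1) p a b y =
    eLpNorm y p (volume.restrict (Set.Icc a b)) +
      sobolevNorm n p a b (derivWithin y (Set.Icc a b)) := by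
  simp only [sobolevNorm_eq_sum]
  rw [Finset.sum_range_succ', add_comm]
  simp [iteratedDerivWithin_succ']

omit [NormedSpace ℝ E] in
lemma eLpNorm_restrict_congr_eqOn (h : Set.EqOn y z (Set.Icc a b)) :
    eLpNorm y p (volume.restrict (Set.Icc a b)) = eLpNorm z p (volume.restrict (Set.Icc a b)) :=
  eLpNorm_congr_ae ((ae_restrict_mem measurableSet_Icc).mono fun _ ht => h ht)

lemma sobolevNorm_congr (h : Set.EqOn y z (Set.Icc a b)) :
    sobolevNorm n p a b y = sobolevNorm n p a b z := by
  simp only [sobolevNorm_eq_sum]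
  exact Finset.sum_congr rfl fun k _ => eLpNorm_restrict_congr_eqOn (iteratedDerivWithin_congr h)

lemma MemSobolev.congr (hab : a ≤ b) (hy : MemSobolev n p a b y) (h : Set.EqOn y z (Set.Icc a b)) :
    MemSobolev n p a b z := by
  have ae_of {u v : ℝ → E} (h : Set.EqOn u v (Set.Icc a b)) :
      u =ᵐ[volume.restrict (Set.Icc a b)] v :=
    (ae_restrict_mem measurableSet_Icc).mono fun _ ht => h ht
  cases n with
  | zero => exact MemLp.ae_eq (ae_of h) hy
  | succ n =>
    obtain ⟨h1, h2, h3⟩ := hy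
    refine ⟨h1.congr h.symm, h2.congr_eqOn ?_, h3.ae_eq (ae_of (iteratedDerivWithin_congr h))⟩
    rw [Set.uIcc_of_le hab]
    exact iteratedDerivWithin_congr h

lemma MemSobolev.continuousOn (hy : MemSobolev (n + 1) p a b y) : ContinuousOn y (Set.Icc a b) :=
  hy.1.continuousOn

omit [NormedSpace ℝ E] in
lemma ContinuousOn.memLp_restrict_Icc (hy : ContinuousOn y (Set.Icc a b)) :
    MemLp y p (volume.restrict (Set.Icc a b)) := by
  obtain ⟨K, hK⟩ := isCompact_Icc.exists_bound_of_continuousOn hy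
  exact MemLp.of_bound (hy.aestronglyMeasurable measurableSet_Icc) K
    ((ae_restrict_mem measurableSet_Icc).mono hK)

lemma MemSobolev.memLp (hy : MemSobolev n p a b y) :
    MemLp y p (volume.restrict (Set.Icc a b)) := by
  cases n with
  | zero => exact hy
  | succ n => exact hy.continuousOn.memLp_restrict_Icc

lemma MemSobolev.aestronglyMeasurable (hy : MemSobolev n p a b y) :
    AEStronglyMeasurable y (volume.restrict (Set.Icc a b)) := hy.memLp.1

lemma MemSobolev.integrableOn (hp : 1 ≤ p) (hy : MemSobolev n p a b y) :
    IntegrableOn y (Set.Icc a b) := hy.memLp.integrable hp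

/-- The recursion starts at order two: at order one the derivative exists only almost everywhere,
and absolute continuity replaces differentiability. -/
lemma memSobolev_succ_succ_iff (hab : a < b) :
    MemSobolev (n + 2) p a b y ↔ DifferentiableOn ℝ y (Set.Icc a b) ∧
      MemSobolev (n + 1) p a b (derivWithin y (Set.Icc a b)) := by
  simp only [MemSobolev]
  rw [show ((n + 1 : ℕ) : WithTop ℕ∞) = (n : WithTop ℕ∞) + 1 by norm_cast,
    contDiffOn_succ_iff_derivWithin (uniqueDiffOn_Icc hab), iteratedDerivWithin_succ' (n := n),
    iteratedDerivWithin_succ' (n := n + 1)]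
  simp [and_assoc]

lemma MemSobolev.derivWithin_mem (hab : a < b) (hy : MemSobolev (n + 1) p a b y) :
    MemSobolev n p a b (derivWithin y (Set.Icc a b)) := by
  cases n with
  | zero => simpa [MemSobolev, iteratedDerivWithin_one] using hy.2.2
  | succ n => exact ((memSobolev_succ_succ_iff hab).1 hy).2

lemma MemSobolev.isPrimitive [FiniteDimensional ℝ E] (hab : a < b) (hp : 1 ≤ p)
    (hy : MemSobolev (n + 1) p a b y) :
    IsPrimitive a b y (derivWithin y (Set.Icc a b)) := by
  refine IsPrimitive.of_ac_derivWithin hab ?_ ((hy.derivWithin_mem hab).integrableOn hp)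
  cases n with
  | zero => simpa [MemSobolev] using hy.2.1
  | succ n =>
    refine ContDiffOn.absolutelyContinuousOnInterval ?_
    rw [Set.uIcc_of_le hab.le]
    exact hy.1.of_le (by norm_cast; omega)

variable [CompleteSpace E]

/-- Together with its converse `MemSobolev.exists_isPrimitive`, this identifies `W_p^{n+1}` with the
primitives of `W_p^n` functions. Inductions on the order then work with `g` in place of iterated
derivatives. -/
lemma IsPrimitive.memSobolev (hab : a < b) (h : IsPrimitive a b y g) (hg : MemSobolev n p a b g) :
    MemSobolev (n + 1) p a b y := by
  cases n with
  | zero =>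
    refine ⟨?_, by simpa using h.absolutelyContinuousOnInterval hab.le, ?_⟩
    · simpa using h.continuousOn hab.le
    · change MemLp (iteratedDerivWithin 1 y (Set.Icc a b)) p (volume.restrict (Set.Icc a b))
      rw [iteratedDerivWithin_one]
      exact MemLp.ae_eq (h.ae_derivWithin_eq hab).symm hg
  | succ n =>
    have hgc := hg.continuousOn
    refine (memSobolev_succ_succ_iff hab).2
      ⟨fun t ht => (h.hasDerivWithinAt hab.le hgc ht).differentiableWithinAt, ?_⟩
    exact hg.congr hab.le (h.derivWithin_eqOn hab hgc).symm

lemma IsPrimitive.sobolevNorm_succ (hab : a < b) (h : IsPrimitive a b y g)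
    (hg : MemSobolev n p a b g) :
    sobolevNorm (n + 1) p a b y =
      eLpNorm y p (volume.restrict (Set.Icc a b)) + sobolevNorm n p a b g := by
  rw [sobolevNorm_succ_derivWithin]
  congr 1
  cases n with
  | zero => rw [sobolevNorm_zero, sobolevNorm_zero, eLpNorm_congr_ae (h.ae_derivWithin_eq hab)]
  | succ n => exact sobolevNorm_congr (h.derivWithin_eqOn hab hg.continuousOn)

lemma memSobolev_const (hab : a < b) (c : E) : MemSobolev n p a b fun _ => c := by
  induction n generalizing c with
  | zero => exact memLp_const c
  | succ n ih =>
    refine IsPrimitive.memSobolev hab (g := fun _ => 0) ⟨integrableOn_zero, fun t _ => by simp⟩ (ih 0)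

omit [CompleteSpace E]
variable [FiniteDimensional ℝ E] [FiniteDimensional ℝ F] [FiniteDimensional ℝ G]

lemma MemSobolev.exists_isPrimitive (hab : a < b) (hp : 1 ≤ p) (hy : MemSobolev (n + 1) p a b y) :
    ∃ g, MemSobolev n p a b g ∧ IsPrimitive a b y g :=
  ⟨_, hy.derivWithin_mem hab, hy.isPrimitive hab hp⟩

lemma MemSobolev.of_succ (hab : a < b) (hp : 1 ≤ p) (hy : MemSobolev (n + 1) p a b y) :
    MemSobolev n p a b y := by
  have := FiniteDimensional.complete ℝ E
  induction n generalizing y with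
  | zero => exact hy.memLp
  | succ n ih =>
    obtain ⟨g, hg, h⟩ := hy.exists_isPrimitive hab hp
    exact h.memSobolev hab (ih hg)

lemma MemSobolev.mono (hab : a < b) (hp : 1 ≤ p) (hkn : k ≤ n) (hy : MemSobolev n p a b y) :
    MemSobolev k p a b y := by
  induction n, hkn using Nat.le_induction with
  | base => exact hy
  | succ n _ ih => exact ih (hy.of_succ hab hp)

omit [FiniteDimensional ℝ E] in
lemma sobolevNorm_mono (hkn : k ≤ n) : sobolevNorm k p a b y ≤ sobolevNorm n p a b y := by
  rw [sobolevNorm_eq_sum, sobolevNorm_eq_sum]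
  exact Finset.sum_le_sum_of_subset (Finset.range_mono (by omega))

omit [FiniteDimensional ℝ E] in
lemma MemSobolev.sobolevNorm_lt_top (hab : a < b) (hy : MemSobolev n p a b y) :
    sobolevNorm n p a b y < ∞ := by
  induction n generalizing y with
  | zero => rw [sobolevNorm_zero]; exact hy.2
  | succ n ih =>
    rw [sobolevNorm_succ_derivWithin]
    exact ENNReal.add_lt_top.2 ⟨hy.memLp.2, ih (hy.derivWithin_mem hab)⟩

lemma MemSobolev.add (hab : a < b) (hp : 1 ≤ p) (hy : MemSobolev n p a b y)
    (hz : MemSobolev n p a b z) : MemSobolev n p a b (y + z) := by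
  have := FiniteDimensional.complete ℝ E
  induction n generalizing y z with
  | zero => exact MemLp.add hy hz
  | succ n ih =>
    obtain ⟨g, hg, h⟩ := hy.exists_isPrimitive hab hp
    obtain ⟨g', hg', h'⟩ := hz.exists_isPrimitive hab hp
    exact (h.add h').memSobolev hab (ih hg hg')

lemma MemSobolev.sobolevNorm_add_le (hab : a < b) (hp : 1 ≤ p) (hy : MemSobolev n p a b y)
    (hz : MemSobolev n p a b z) :
    sobolevNorm n p a b (y + z) ≤ sobolevNorm n p a b y + sobolevNorm n p a b z := by
  have := FiniteDimensional.complete ℝ E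
  induction n generalizing y z with
  | zero => simpa only [sobolevNorm_zero] using eLpNorm_add_le hy.1 hz.1 hp
  | succ n ih =>
    obtain ⟨g, hg, h⟩ := hy.exists_isPrimitive hab hp
    obtain ⟨g', hg', h'⟩ := hz.exists_isPrimitive hab hp
    rw [(h.add h').sobolevNorm_succ hab (hg.add hab hp hg'), h.sobolevNorm_succ hab hg,
      h'.sobolevNorm_succ hab hg', add_add_add_comm]
    exact add_le_add (eLpNorm_add_le hy.memLp.1 hz.memLp.1 hp) (ih hg hg')

lemma MemSobolev.clm (hab : a < b) (hp : 1 ≤ p) (hy : MemSobolev n p a b y) (T : E →L[ℝ] F) :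
    MemSobolev n p a b fun t => T (y t) := by
  have := FiniteDimensional.complete ℝ E
  have := FiniteDimensional.complete ℝ F
  induction n generalizing y with
  | zero => exact T.comp_memLp' hy
  | succ n ih =>
    obtain ⟨g, hg, h⟩ := hy.exists_isPrimitive hab hp
    exact (h.clm T).memSobolev hab (ih hg)

lemma MemSobolev.neg (hab : a < b) (hp : 1 ≤ p) (hy : MemSobolev n p a b y) :
    MemSobolev n p a b (-y) := hy.clm hab hp (-ContinuousLinearMap.id ℝ E)

lemma MemSobolev.sub (hab : a < b) (hp : 1 ≤ p) (hy : MemSobolev n p a b y)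
    (hz : MemSobolev n p a b z) : MemSobolev n p a b (y - z) := by
  rw [sub_eq_add_neg]; exact hy.add hab hp (hz.neg hab hp)

omit [FiniteDimensional ℝ E] in
lemma iteratedDerivWithin_neg_eq_neg (s : Set ℝ) :
    iteratedDerivWithin k (-y) s = -iteratedDerivWithin k y s := by
  induction k with
  | zero => simp
  | succ k ih =>
    rw [iteratedDerivWithin_succ, ih, iteratedDerivWithin_succ]
    ext t; simp [derivWithin.neg]

omit [FiniteDimensional ℝ E] in
lemma sobolevNorm_neg : sobolevNorm n p a b (-y) = sobolevNorm n p a b y := by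
  simp only [sobolevNorm_eq_sum, iteratedDerivWithin_neg_eq_neg, eLpNorm_neg]

lemma MemSobolev.sobolevNorm_sub_le (hab : a < b) (hp : 1 ≤ p) (hy : MemSobolev n p a b y)
    (hz : MemSobolev n p a b z) :
    sobolevNorm n p a b (y - z) ≤ sobolevNorm n p a b y + sobolevNorm n p a b z := by
  rw [sub_eq_add_neg, ← sobolevNorm_neg (y := z)]
  exact hy.sobolevNorm_add_le hab hp (hz.neg hab hp)

end Sobolev

/-! ### Embedding into continuous functions and product estimates -/

section Embedding

variable {E F G : Type*} [NormedAddCommGroup E] [NormedSpace ℝ E]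
  [NormedAddCommGroup F] [NormedSpace ℝ F] [NormedAddCommGroup G] [NormedSpace ℝ G]
  {a b : ℝ} {p : ℝ≥0∞} {n k : ℕ} {y g : ℝ → E}

omit [NormedSpace ℝ E] in
-- Hölder's inequality against the constant function 1; the exponent is `1/p'`.
lemma lintegral_enorm_Icc_le_eLpNorm (hp : 1 ≤ p) {s t : ℝ}
    (hg : AEStronglyMeasurable g (volume.restrict (Set.Icc s t))) :
    ∫⁻ x in Set.Icc s t, ‖g x‖ₑ ≤ eLpNorm g p (volume.restrict (Set.Icc s t)) *
      ENNReal.ofReal (t - s) ^ (1 - 1 / p.toReal) := by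
  have h := eLpNorm_le_eLpNorm_mul_rpow_measure_univ hp hg
  simpa [eLpNorm_one_eq_lintegral_enorm] using h

lemma IsPrimitive.enorm_sub_le (h : IsPrimitive a b y g) {s t : ℝ} (hs : s ∈ Set.Icc a b)
    (ht : t ∈ Set.Icc a b) (hst : s ≤ t) : ‖y t - y s‖ₑ ≤ ∫⁻ x in Set.Icc s t, ‖g x‖ₑ := by
  rw [h.sub_eq hs ht, ← setIntegral_Icc_eq_intervalIntegral hst]
  exact enorm_integral_le_lintegral_enorm _

lemma IsPrimitive.enorm_sub_le' (h : IsPrimitive a b y g) {s t : ℝ} (hs : s ∈ Set.Icc a b)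
    (ht : t ∈ Set.Icc a b) : ‖y t - y s‖ₑ ≤ ∫⁻ x in Set.Icc a b, ‖g x‖ₑ := by
  rcases le_total s t with hst | hst
  · exact (h.enorm_sub_le hs ht hst).trans
      (lintegral_mono_set (Set.Icc_subset_Icc hs.1 ht.2))
  · rw [← enorm_neg, neg_sub]
    exact (h.enorm_sub_le ht hs hst).trans
      (lintegral_mono_set (Set.Icc_subset_Icc ht.1 hs.2))

/-- The embedding constant of `W_p^1([a,b])` into `C[a,b]`. -/
noncomputable def embeddingConst (p : ℝ≥0∞) (a b : ℝ) : ℝ≥0∞ :=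
  ((ENNReal.ofReal (b - a))⁻¹ + 1) * ENNReal.ofReal (b - a) ^ (1 - 1 / p.toReal)

lemma one_sub_one_div_toReal_nonneg (hp : 1 ≤ p) : 0 ≤ 1 - 1 / p.toReal := by
  by_cases h : p = ∞
  · simp [h]
  · have : 1 ≤ p.toReal := by
      rw [← ENNReal.toReal_one]; exact ENNReal.toReal_mono h hp
    rw [sub_nonneg, div_le_one (by linarith)]; exact this

lemma embeddingConst_ne_top (hab : a < b) (hp : 1 ≤ p) : embeddingConst p a b ≠ ∞ := by
  refine ENNReal.mul_ne_top (ENNReal.add_ne_top.2 ⟨?_, by simp⟩)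
    (ENNReal.rpow_ne_top_of_nonneg (one_sub_one_div_toReal_nonneg hp) (by simp))
  simpa using hab

/-- Average the inequality `‖y t‖ ≤ ‖y s‖ + ∫ ‖g‖` over `s` in `[a,b]`, then bound both integrals by
Hölder's inequality. -/
lemma IsPrimitive.enorm_le (hab : a < b) (hp : 1 ≤ p) (h : IsPrimitive a b y g) {t : ℝ}
    (ht : t ∈ Set.Icc a b) :
    ‖y t‖ₑ ≤ embeddingConst p a b * (eLpNorm y p (volume.restrict (Set.Icc a b)) +
      eLpNorm g p (volume.restrict (Set.Icc a b))) := by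
  set V := ENNReal.ofReal (b - a)
  set J := ∫⁻ x in Set.Icc a b, ‖g x‖ₑ
  have hV0 : V ≠ 0 := by simpa [V] using hab
  have hV : V ≠ ∞ := by simp [V]
  have hy := (h.continuousOn hab.le).aestronglyMeasurable (μ := volume) measurableSet_Icc
  have h1 : ∫⁻ _ in Set.Icc a b, ‖y t‖ₑ ≤ ∫⁻ s in Set.Icc a b, (‖y s‖ₑ + J) := by
    refine setLIntegral_mono_ae (hy.enorm.add_const J) (Eventually.of_forall fun s hs => ?_)
    calc ‖y t‖ₑ = ‖y s + (y t - y s)‖ₑ := by congr 1; abel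
      _ ≤ ‖y s‖ₑ + ‖y t - y s‖ₑ := enorm_add_le _ _
      _ ≤ ‖y s‖ₑ + J := by gcongr; exact h.enorm_sub_le' hs ht
  rw [lintegral_add_right _ measurable_const] at h1
  simp only [lintegral_const, Measure.restrict_apply_univ, Real.volume_Icc] at h1
  have h2 := lintegral_enorm_Icc_le_eLpNorm hp hy
  have h3 := lintegral_enorm_Icc_le_eLpNorm hp h.integrableOn.aestronglyMeasurable
  have h4 : ‖y t‖ₑ ≤ V⁻¹ * (∫⁻ s in Set.Icc a b, ‖y s‖ₑ) + J := by
    calc ‖y t‖ₑ = V⁻¹ * (‖y t‖ₑ * V) := by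
          rw [mul_comm ‖y t‖ₑ V, ← mul_assoc, ENNReal.inv_mul_cancel hV0 hV, one_mul]
      _ ≤ V⁻¹ * ((∫⁻ s in Set.Icc a b, ‖y s‖ₑ) + J * V) := by gcongr
      _ = _ := by
          rw [mul_add, mul_comm J V, ← mul_assoc V⁻¹ V J, ENNReal.inv_mul_cancel hV0 hV, one_mul]
  refine h4.trans ?_
  have e1 : V⁻¹ ≤ V⁻¹ + 1 := le_self_add
  have e2 : (1 : ℝ≥0∞) ≤ V⁻¹ + 1 := le_add_self
  rw [embeddingConst, mul_add]
  refine add_le_add ?_ ?_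
  · calc _ ≤ (V⁻¹ + 1) * (eLpNorm y p (volume.restrict (Set.Icc a b)) * V ^ (1 - 1 / p.toReal)) := by
          gcongr
      _ = _ := by ring
  · calc J = 1 * J := (one_mul _).symm
      _ ≤ (V⁻¹ + 1) * (eLpNorm g p (volume.restrict (Set.Icc a b)) * V ^ (1 - 1 / p.toReal)) := by
          gcongr
      _ = _ := by ring

lemma eLpNorm_le_sobolevNorm :
    eLpNorm y p (volume.restrict (Set.Icc a b)) ≤ sobolevNorm n p a b y := by
  rw [← sobolevNorm_zero]
  exact sobolevNorm_mono (Nat.zero_le n)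

variable [FiniteDimensional ℝ E] [FiniteDimensional ℝ F] [FiniteDimensional ℝ G]

lemma MemSobolev.enorm_le (hab : a < b) (hp : 1 ≤ p) (hy : MemSobolev (n + 1) p a b y) {t : ℝ}
    (ht : t ∈ Set.Icc a b) : ‖y t‖ₑ ≤ embeddingConst p a b * sobolevNorm (n + 1) p a b y := by
  refine ((hy.isPrimitive hab hp).enorm_le hab hp ht).trans ?_
  rw [sobolevNorm_succ_derivWithin]
  gcongr
  exact eLpNorm_le_sobolevNorm

/-- The continuity assumption matters only in order 0, since `L_p` is not closed under products; in
positive order it is automatic. It survives the induction because each term of the product rule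
retains an undifferentiated, continuous factor. -/
lemma MemSobolev.bilin (hab : a < b) (hp : 1 ≤ p) (L : E →L[ℝ] F →L[ℝ] G) {z : ℝ → F}
    (hy : MemSobolev n p a b y) (hz : MemSobolev n p a b z)
    (hc : ContinuousOn y (Set.Icc a b) ∨ ContinuousOn z (Set.Icc a b)) :
    MemSobolev n p a b fun t => L (y t) (z t) := by
  have := FiniteDimensional.complete ℝ E
  have := FiniteDimensional.complete ℝ F
  have := FiniteDimensional.complete ℝ G
  induction n generalizing y z with
  | zero =>
    have hm := L.aestronglyMeasurable_comp₂ hy.1 hz.1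
    rcases hc with hc | hc
    · obtain ⟨K, hK⟩ := isCompact_Icc.exists_bound_of_continuousOn hc
      refine MemLp.of_le_mul (c := ‖L‖ * K) hz hm ?_
      filter_upwards [ae_restrict_mem measurableSet_Icc] with t ht
      refine (L.le_opNorm₂ _ _).trans ?_
      gcongr
      exact hK t ht
    · obtain ⟨K, hK⟩ := isCompact_Icc.exists_bound_of_continuousOn hc
      refine MemLp.of_le_mul (c := ‖L‖ * K) hy hm ?_
      filter_upwards [ae_restrict_mem measurableSet_Icc] with t ht
      refine (L.le_opNorm₂ _ _).trans ?_
      calc ‖L‖ * ‖y t‖ * ‖z t‖ ≤ ‖L‖ * ‖y t‖ * K := by gcongr; exact hK t ht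
        _ = _ := by ring
  | succ n ih =>
    obtain ⟨g, hg, h⟩ := hy.exists_isPrimitive hab hp
    obtain ⟨w, hw, h'⟩ := hz.exists_isPrimitive hab hp
    refine (h.bilin hab.le L h').memSobolev hab ?_
    exact (ih (hy.of_succ hab hp) hw (.inl hy.continuousOn)).add hab hp
      (ih hg (hz.of_succ hab hp) (.inr hz.continuousOn))

omit [FiniteDimensional ℝ E] [FiniteDimensional ℝ F] [FiniteDimensional ℝ G] in
lemma enorm_bilin_le (L : E →L[ℝ] F →L[ℝ] G) (u : E) (v : F) : ‖L u v‖ₑ ≤ ‖L‖ₑ * ‖u‖ₑ * ‖v‖ₑ := by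
  have h : ‖L u v‖₊ ≤ ‖L‖₊ * ‖u‖₊ * ‖v‖₊ := L.le_opNorm₂ u v
  simp only [enorm]
  exact_mod_cast h

omit [FiniteDimensional ℝ E] [FiniteDimensional ℝ F] [FiniteDimensional ℝ G] in
lemma eLpNorm_bilin_le_left (L : E →L[ℝ] F →L[ℝ] G) {z : ℝ → F} {M : ℝ≥0∞}
    (hy : AEStronglyMeasurable y (volume.restrict (Set.Icc a b)))
    (hM : ∀ t ∈ Set.Icc a b, ‖z t‖ₑ ≤ M) :
    eLpNorm (fun t => L (y t) (z t)) p (volume.restrict (Set.Icc a b)) ≤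
      ‖L‖ₑ * M * eLpNorm y p (volume.restrict (Set.Icc a b)) := by
  refine eLpNorm_le_mul_eLpNorm_of_ae_le_mul'' p hy ?_
  filter_upwards [ae_restrict_mem measurableSet_Icc] with t ht
  calc ‖L (y t) (z t)‖ₑ ≤ ‖L‖ₑ * ‖y t‖ₑ * ‖z t‖ₑ := enorm_bilin_le L _ _
    _ ≤ ‖L‖ₑ * ‖y t‖ₑ * M := by gcongr; exact hM t ht
    _ = _ := by ring

omit [FiniteDimensional ℝ E] [FiniteDimensional ℝ F] [FiniteDimensional ℝ G] in
lemma eLpNorm_bilin_le_right (L : E →L[ℝ] F →L[ℝ] G) {z : ℝ → F} {M : ℝ≥0∞}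
    (hz : AEStronglyMeasurable z (volume.restrict (Set.Icc a b)))
    (hM : ∀ t ∈ Set.Icc a b, ‖y t‖ₑ ≤ M) :
    eLpNorm (fun t => L (y t) (z t)) p (volume.restrict (Set.Icc a b)) ≤
      ‖L‖ₑ * M * eLpNorm z p (volume.restrict (Set.Icc a b)) := by
  refine eLpNorm_le_mul_eLpNorm_of_ae_le_mul'' p hz ?_
  filter_upwards [ae_restrict_mem measurableSet_Icc] with t ht
  calc ‖L (y t) (z t)‖ₑ ≤ ‖L‖ₑ * ‖y t‖ₑ * ‖z t‖ₑ := enorm_bilin_le L _ _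
    _ ≤ ‖L‖ₑ * M * ‖z t‖ₑ := by gcongr; exact hM t ht

/-- The constant in the product estimate for `W_p^n`. -/
noncomputable def productConst (p : ℝ≥0∞) (a b : ℝ) (B : ℝ≥0∞) : ℕ → ℝ≥0∞
  | 0 => B
  | n + 1 => B * embeddingConst p a b + 2 * productConst p a b B n * (embeddingConst p a b + 1)

lemma productConst_ne_top (hab : a < b) (hp : 1 ≤ p) {B : ℝ≥0∞} (hB : B ≠ ∞) :
    productConst p a b B n ≠ ∞ := by
  have h := embeddingConst_ne_top hab hp
  induction n with
  | zero => exact hB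
  | succ n ih =>
    exact ENNReal.add_ne_top.2 ⟨ENNReal.mul_ne_top hB h, ENNReal.mul_ne_top
      (ENNReal.mul_ne_top (by simp) ih) (ENNReal.add_ne_top.2 ⟨h, by simp⟩)⟩

/-- Both factors in `W_p^n`, one of them bounded by `M` on `[a,b]` (only relevant for `n = 0`). -/
lemma MemSobolev.sobolevNorm_bilin_le_aux (hab : a < b) (hp : 1 ≤ p) (L : E →L[ℝ] F →L[ℝ] G)
    {z : ℝ → F} (hy : MemSobolev n p a b y) (hz : MemSobolev n p a b z) (M : ℝ≥0∞) :
    ((∀ t ∈ Set.Icc a b, ‖z t‖ₑ ≤ M) → sobolevNorm n p a b (fun t => L (y t) (z t)) ≤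
      productConst p a b ‖L‖ₑ n * (sobolevNorm n p a b y * (M + sobolevNorm n p a b z))) ∧
    ((∀ t ∈ Set.Icc a b, ‖y t‖ₑ ≤ M) → sobolevNorm n p a b (fun t => L (y t) (z t)) ≤
      productConst p a b ‖L‖ₑ n * ((M + sobolevNorm n p a b y) * sobolevNorm n p a b z)) := by
  have := FiniteDimensional.complete ℝ E
  have := FiniteDimensional.complete ℝ F
  have := FiniteDimensional.complete ℝ G
  induction n generalizing y z M with
  | zero =>
    simp only [sobolevNorm_zero, productConst]
    constructor <;> intro hM
    · refine (eLpNorm_bilin_le_left L hy.1 hM).trans ?_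
      rw [mul_assoc, mul_comm M]
      gcongr
      exact le_self_add
    · refine (eLpNorm_bilin_le_right L hz.1 hM).trans ?_
      rw [mul_assoc]
      gcongr
      exact le_self_add
  | succ n ih =>
    obtain ⟨g, hg, h⟩ := hy.exists_isPrimitive hab hp
    obtain ⟨w, hw, h'⟩ := hz.exists_isPrimitive hab hp
    set e := embeddingConst p a b
    set C := productConst p a b ‖L‖ₑ n
    set Y := sobolevNorm (n + 1) p a b y with hY
    set Z := sobolevNorm (n + 1) p a b z with hZ
    have m1 := hy.of_succ hab hp
    have m2 := hz.of_succ hab hp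
    have p1 := m1.bilin hab hp L hw (.inl hy.continuousOn)
    have p2 := hg.bilin hab hp L m2 (.inr hz.continuousOn)
    have b1 : sobolevNorm n p a b y ≤ Y := sobolevNorm_mono (Nat.le_succ n)
    have b2 : sobolevNorm n p a b z ≤ Z := sobolevNorm_mono (Nat.le_succ n)
    have b3 : sobolevNorm n p a b g ≤ Y := by rw [hY, h.sobolevNorm_succ hab hg]; exact le_add_self
    have b4 : sobolevNorm n p a b w ≤ Z := by rw [hZ, h'.sobolevNorm_succ hab hw]; exact le_add_self
    -- In positive order the sup bounds come from the embedding rather than from `M`. Of the two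
    -- terms of the product rule, one has its bounded factor on the left and the other on the right,
    -- so both halves of the induction hypothesis are needed.
    have key : sobolevNorm (n + 1) p a b (fun t => L (y t) (z t)) ≤
        productConst p a b ‖L‖ₑ (n + 1) * (Y * Z) := by
      rw [(h.bilin hab.le L h').sobolevNorm_succ hab (p1.add hab hp p2)]
      have q0 : eLpNorm (fun t => L (y t) (z t)) p (volume.restrict (Set.Icc a b)) ≤
          ‖L‖ₑ * e * (Y * Z) := by
        refine (eLpNorm_bilin_le_left L hy.aestronglyMeasurable
          fun t ht => hz.enorm_le hab hp ht).trans ?_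
        calc _ ≤ ‖L‖ₑ * (e * Z) * Y := by gcongr; exact eLpNorm_le_sobolevNorm
          _ = _ := by ring
      have q1 : sobolevNorm n p a b (fun t => L (y t) (w t)) ≤ C * (e + 1) * (Y * Z) := by
        refine ((ih m1 hw (e * Y)).2 fun t ht => hy.enorm_le hab hp ht).trans ?_
        calc _ ≤ C * ((e * Y + Y) * Z) := by gcongr
          _ = _ := by ring
      have q2 : sobolevNorm n p a b (fun t => L (g t) (z t)) ≤ C * (e + 1) * (Y * Z) := by
        refine ((ih hg m2 (e * Z)).1 fun t ht => hz.enorm_le hab hp ht).trans ?_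
        calc _ ≤ C * (Y * (e * Z + Z)) := by gcongr
          _ = _ := by ring
      calc _ ≤ ‖L‖ₑ * e * (Y * Z) + (C * (e + 1) * (Y * Z) + C * (e + 1) * (Y * Z)) :=
            add_le_add q0 ((p1.sobolevNorm_add_le hab hp p2).trans (add_le_add q1 q2))
        _ = _ := by simp only [productConst]; ring
    refine ⟨fun _ => key.trans ?_, fun _ => key.trans ?_⟩
    · gcongr; exact le_add_self
    · gcongr; exact le_add_self

lemma MemSobolev.sobolevNorm_bilin_le (hab : a < b) (hp : 1 ≤ p) (L : E →L[ℝ] F →L[ℝ] G)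
    {z : ℝ → F} (hy : MemSobolev n p a b y) (hz : MemSobolev n p a b z) {M : ℝ≥0∞}
    (hM : ∀ t ∈ Set.Icc a b, ‖z t‖ₑ ≤ M) :
    sobolevNorm n p a b (fun t => L (y t) (z t)) ≤
      productConst p a b ‖L‖ₑ n * (sobolevNorm n p a b y * (M + sobolevNorm n p a b z)) :=
  (hy.sobolevNorm_bilin_le_aux hab hp L hz M).1 hM

end Embedding

/-! ### Linear Volterra equations in exponentially weighted norms -/

section Volterra

variable {E : Type*} [NormedAddCommGroup E] [NormedSpace ℝ E] {a b : ℝ}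

lemma IntegrableOn.exp_mul {g : ℝ → ℝ} (hg : IntegrableOn g (Set.Icc a b)) (l t : ℝ) :
    IntegrableOn (fun s => Real.exp (-l * (t - s)) * g s) (Set.Icc a b) :=
  hg.continuousOn_mul (by fun_prop) isCompact_Icc

lemma integral_exp_neg_mul_sub_le {l t : ℝ} (hl : 0 < l) :
    ∫ s in a..t, Real.exp (-l * (t - s)) ≤ 1 / l := by
  have h : ∀ s ∈ Set.uIcc a t, HasDerivAt (fun s => Real.exp (-l * (t - s)) / l)
      (Real.exp (-l * (t - s))) s := fun s _ => by
    have h1 : HasDerivAt (fun s => -l * (t - s)) l s := by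
      simpa using ((hasDerivAt_id s).const_sub t).const_mul (-l)
    have h2 := (h1.exp).div_const l
    rwa [mul_div_assoc, div_self hl.ne', mul_one] at h2
  rw [intervalIntegral.integral_eq_sub_of_hasDerivAt h
    ((by fun_prop : Continuous fun s => Real.exp (-l * (t - s))).intervalIntegrable _ _)]
  simp only [sub_self, mul_zero, Real.exp_zero]
  have : 0 ≤ Real.exp (-l * (t - a)) / l := by positivity
  linarith

/-- An exponential weight makes the Volterra kernel of an integrable function small. -/
lemma exists_forall_integral_exp_mul_le (hab : a ≤ b) {g : ℝ → ℝ} (hg : IntegrableOn g (Set.Icc a b))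
    (hg0 : ∀ s, 0 ≤ g s) {δ : ℝ} (hδ : 0 < δ) :
    ∃ l : ℝ, 0 ≤ l ∧ ∀ t ∈ Set.Icc a b, ∫ s in a..t, Real.exp (-l * (t - s)) * g s ≤ δ := by
  -- Truncate `g` at height `n`: the excess has small integral by dominated convergence, and the
  -- bounded part is damped by the exponential weight.
  have hlim : Tendsto (fun n : ℕ => ∫ s in Set.Icc a b, max (g s - n) 0) atTop (𝓝 0) := by
    have h := tendsto_integral_of_dominated_convergence (μ := volume.restrict (Set.Icc a b))
      (F := fun (n : ℕ) s => max (g s - n) 0) (f := fun _ => (0 : ℝ)) g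
      (fun n => ((hg.aestronglyMeasurable.sub aestronglyMeasurable_const).sup
        aestronglyMeasurable_const)) hg
      (fun n => Eventually.of_forall fun s => ?_) (Eventually.of_forall fun s => ?_)
    · simpa using h
    · rw [Real.norm_of_nonneg (le_max_right _ _)]
      exact max_le (sub_le_self _ (Nat.cast_nonneg n)) (hg0 s)
    · obtain ⟨N, hN⟩ := exists_nat_ge (g s)
      refine tendsto_const_nhds.congr' ?_
      filter_upwards [eventually_ge_atTop N] with n hn
      have : (N : ℝ) ≤ n := by exact_mod_cast hn
      rw [max_eq_right]
      linarith
  obtain ⟨n, hn⟩ := (hlim.eventually (gt_mem_nhds (half_pos hδ))).exists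
  -- This rate makes `n / l ≤ δ / 2`; the added 1 keeps it positive when `n = 0`.
  have hl : 0 < 2 * n / δ + 1 := by positivity
  refine ⟨2 * n / δ + 1, hl.le, fun t ht => ?_⟩
  set l := 2 * n / δ + 1 with hldef
  have ha : a ∈ Set.Icc a b := ⟨le_rfl, hab⟩
  have hi1 : IntegrableOn (fun s => max (g s - n) 0) (Set.Icc a b) :=
    (hg.sub (integrable_const _)).sup (integrable_const _)
  have hi2 : Continuous fun s => (n : ℝ) * Real.exp (-l * (t - s)) := by fun_prop
  calc ∫ s in a..t, Real.exp (-l * (t - s)) * g s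
      ≤ ∫ s in a..t, (max (g s - n) 0 + n * Real.exp (-l * (t - s))) := by
        refine intervalIntegral.integral_mono_on ht.1
          ((IntegrableOn.exp_mul hg l t).intervalIntegrable_of_mem ha ht)
          ((hi1.intervalIntegrable_of_mem ha ht).add (hi2.intervalIntegrable _ _)) fun s hs => ?_
        have e0 : 0 < Real.exp (-l * (t - s)) := Real.exp_pos _
        have e1 : Real.exp (-l * (t - s)) ≤ 1 := by
          rw [Real.exp_le_one_iff]
          have := mul_nonneg hl.le (sub_nonneg.2 hs.2)
          linarith
        have h1 : g s - n ≤ max (g s - n) 0 := le_max_left _ _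
        have h2 : 0 ≤ max (g s - n) 0 := le_max_right _ _
        nlinarith
    _ = (∫ s in a..t, max (g s - n) 0) + n * ∫ s in a..t, Real.exp (-l * (t - s)) := by
        rw [intervalIntegral.integral_add (hi1.intervalIntegrable_of_mem ha ht)
          (hi2.intervalIntegrable _ _), intervalIntegral.integral_const_mul]
    _ ≤ δ / 2 + n * (1 / l) := by
        refine add_le_add (le_trans ?_ hn.le) ?_
        · rw [← setIntegral_Icc_eq_intervalIntegral ht.1]
          exact setIntegral_mono_set hi1 (Eventually.of_forall fun s => le_max_right _ _)
            (Set.Icc_subset_Icc_right ht.2).eventuallyLE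
        · gcongr
          exact integral_exp_neg_mul_sub_le hl
    _ ≤ δ := by
        have : n * (1 / l) ≤ δ / 2 := by
          rw [mul_one_div, div_le_iff₀ hl, hldef]
          have : δ / 2 * (2 * n / δ + 1) = n + δ / 2 := by field_simp
          linarith
        linarith

variable {A A₀ : ℝ → E →L[ℝ] E} {y h : ℝ → E} {l κ : ℝ}

lemma IntegrableOn.clm_apply (hA : IntegrableOn A (Set.Icc a b)) (hy : ContinuousOn y (Set.Icc a b)) :
    IntegrableOn (fun s => A s (y s)) (Set.Icc a b) := by
  obtain ⟨K, hK⟩ := isCompact_Icc.exists_bound_of_continuousOn hy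
  refine Integrable.mono' (hA.norm.mul_const K)
    ((ContinuousLinearMap.id ℝ (E →L[ℝ] E)).aestronglyMeasurable_comp₂ hA.aestronglyMeasurable
      (hy.aestronglyMeasurable measurableSet_Icc)) ?_
  filter_upwards [ae_restrict_mem measurableSet_Icc] with t ht
  refine ((A t).le_opNorm _).trans ?_
  gcongr
  exact hK t ht

/-- In the sup norm weighted by `exp (-l (t - a))` the Volterra operator has norm at most `κ`,
because the weights at `s` and `t` differ by exactly the factor `exp (-l (t - s))` in the kernel
bound. -/
lemma norm_integral_clm_apply_le (hA : IntegrableOn A (Set.Icc a b))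
    (hκ : ∀ t ∈ Set.Icc a b, ∫ s in a..t, Real.exp (-l * (t - s)) * ‖A s‖ ≤ κ) {N : ℝ} (hN : 0 ≤ N)
    (hyN : ∀ s ∈ Set.Icc a b, ‖y s‖ ≤ Real.exp (l * (s - a)) * N) {t : ℝ} (ht : t ∈ Set.Icc a b) :
    ‖∫ s in a..t, A s (y s)‖ ≤ Real.exp (l * (t - a)) * (κ * N) := by
  have ha : a ∈ Set.Icc a b := ⟨le_rfl, ht.1.trans ht.2⟩
  have hi := ((IntegrableOn.exp_mul hA.norm l t).intervalIntegrable_of_mem ha ht)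
  calc ‖∫ s in a..t, A s (y s)‖
      ≤ ∫ s in a..t, Real.exp (l * (t - a)) * N * (Real.exp (-l * (t - s)) * ‖A s‖) := by
        refine intervalIntegral.norm_integral_le_of_norm_le ht.1
          (Eventually.of_forall fun s hs => ?_) (hi.const_mul _)
        refine ((A s).le_opNorm _).trans ?_
        have e : Real.exp (l * (t - a)) * Real.exp (-l * (t - s)) = Real.exp (l * (s - a)) := by
          rw [← Real.exp_add]; congr 1; ring
        calc ‖A s‖ * ‖y s‖ ≤ ‖A s‖ * (Real.exp (l * (s - a)) * N) := by
              gcongr; exact hyN s ⟨hs.1.le, hs.2.trans ht.2⟩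
          _ = _ := by rw [← e]; ring
    _ = Real.exp (l * (t - a)) * N * ∫ s in a..t, Real.exp (-l * (t - s)) * ‖A s‖ :=
        intervalIntegral.integral_const_mul _ _
    _ ≤ Real.exp (l * (t - a)) * N * κ := by gcongr; exact hκ t ht
    _ = _ := by ring

/-- Existence for linear Volterra integral equations with integrable coefficient. -/
lemma exists_continuousOn_eq_sub_integral [CompleteSpace E] (hab : a ≤ b)
    (hA : IntegrableOn A (Set.Icc a b)) (hh : ContinuousOn h (Set.Icc a b)) :
    ∃ y : ℝ → E, ContinuousOn y (Set.Icc a b) ∧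
      ∀ t ∈ Set.Icc a b, y t = h t - ∫ s in a..t, A s (y s) := by
  obtain ⟨l, _, hl⟩ := exists_forall_integral_exp_mul_le hab hA.norm (fun _ => norm_nonneg _)
    (half_pos one_pos)
  have ha : a ∈ Set.Icc a b := ⟨le_rfl, hab⟩
  -- Here `w u` is the unknown and `u` its weighted form, so the weighted contraction becomes one in
  -- the ordinary metric of `C(Set.Icc a b, E)`.
  let w (u : C(Set.Icc a b, E)) (s : ℝ) : E := Real.exp (l * (s - a)) • Set.IccExtend hab u s
  have hw (u : C(Set.Icc a b, E)) : ContinuousOn (w u) (Set.Icc a b) := by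
    have : Continuous (Set.IccExtend hab u) := u.continuous.Icc_extend'
    exact Continuous.continuousOn (by fun_prop)
  have hint (u : C(Set.Icc a b, E)) : IntegrableOn (fun s => A s (w u s)) (Set.Icc a b) :=
    IntegrableOn.clm_apply hA (hw u)
  have hIc (u : C(Set.Icc a b, E)) :
      ContinuousOn (fun t => ∫ s in a..t, A s (w u s)) (Set.Icc a b) :=
    (IsPrimitive.of_eq_const_add hab (c := 0) (hint u) fun t _ => by simp).continuousOn hab
  let T (u : C(Set.Icc a b, E)) : C(Set.Icc a b, E) :=
    ⟨fun t => Real.exp (-(l * (t - a))) • (h t - ∫ s in a..t, A s (w u s)), by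
      have := continuousOn_iff_continuous_domRestrict.mp (hh.sub (hIc u))
      exact Continuous.smul (by fun_prop) this⟩
  have hT : ContractingWith (1 / 2) T := by
    refine ⟨by norm_num, LipschitzWith.of_dist_le_mul fun u v => ?_⟩
    rw [ContinuousMap.dist_le (by positivity)]
    intro t
    have e : ∫ s in a..(t : ℝ), A s (w v s - w u s) =
        (∫ s in a..(t : ℝ), A s (w v s)) - ∫ s in a..(t : ℝ), A s (w u s) := by
      rw [← intervalIntegral.integral_sub ((hint v).intervalIntegrable_of_mem ha t.2)
        ((hint u).intervalIntegrable_of_mem ha t.2)]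
      simp
    have key := norm_integral_clm_apply_le (y := fun s => w v s - w u s) hA hl
      (dist_nonneg (x := u) (y := v)) (fun s hs => ?_) t.2
    · have : T u t - T v t =
          Real.exp (-(l * (t - a))) • ∫ s in a..(t : ℝ), A s (w v s - w u s) := by
        simp only [T, ContinuousMap.coe_mk, e]
        rw [← smul_sub]; congr 1; abel
      rw [dist_eq_norm, this, norm_smul, Real.norm_of_nonneg (Real.exp_pos _).le]
      calc _ ≤ Real.exp (-(l * (t - a))) * (Real.exp (l * (t - a)) * (1 / 2 * dist u v)) := by
            gcongr
        _ = _ := by rw [← mul_assoc, ← Real.exp_add]; simp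
    · simp only [w]
      rw [← smul_sub, norm_smul, Real.norm_of_nonneg (Real.exp_pos _).le,
        Set.IccExtend_of_mem hab _ hs, Set.IccExtend_of_mem hab _ hs, ← dist_eq_norm, dist_comm]
      gcongr
      exact ContinuousMap.dist_apply_le_dist _
  have : Nonempty C(Set.Icc a b, E) := ⟨0⟩
  have hfix := hT.fixedPoint_isFixedPt
  set u := hT.fixedPoint
  refine ⟨w u, hw u, fun t ht => ?_⟩
  have h1 : u ⟨t, ht⟩ = Real.exp (-(l * (t - a))) • (h t - ∫ s in a..t, A s (w u s)) := by
    conv_lhs => rw [← hfix]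
    rfl
  have h2 : w u t = Real.exp (l * (t - a)) • u ⟨t, ht⟩ := by
    simp only [w]; rw [Set.IccExtend_of_mem hab _ ht]
  rw [h2, h1, smul_smul, ← Real.exp_add]
  simp

/-- A priori bound for linear Volterra integral equations, uniform under small `L_1`-perturbations of
the coefficient. -/
lemma exists_forall_norm_le_of_volterra (hab : a ≤ b) (hA₀ : IntegrableOn A₀ (Set.Icc a b)) :
    ∃ C : ℝ, 0 ≤ C ∧ ∀ (A : ℝ → E →L[ℝ] E) (c : E) (h z : ℝ → E), IntegrableOn A (Set.Icc a b) →
      ∫ s in Set.Icc a b, ‖A s - A₀ s‖ ≤ 1 / 4 → IntegrableOn h (Set.Icc a b) →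
      ContinuousOn z (Set.Icc a b) →
      (∀ t ∈ Set.Icc a b, z t = c + ∫ s in a..t, (h s - A s (z s))) →
      ∀ t ∈ Set.Icc a b, ‖z t‖ ≤ C * (‖c‖ + ∫ s in Set.Icc a b, ‖h s‖) := by
  -- The weight depends on `A₀` alone. Its share 1/4 and the perturbation's 1/4 add up to the
  -- contraction constant 1/2, uniformly in `A`.
  obtain ⟨l, hl0, hl⟩ := exists_forall_integral_exp_mul_le hab hA₀.norm (fun _ => norm_nonneg _)
    (δ := 1 / 4) (by norm_num)
  refine ⟨Real.exp (l * (b - a)) * 2, by positivity, fun A c h z hA hAA hh hz hzz t ht => ?_⟩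
  have ha : a ∈ Set.Icc a b := ⟨le_rfl, hab⟩
  have hκ : ∀ t ∈ Set.Icc a b, ∫ s in a..t, Real.exp (-l * (t - s)) * ‖A s‖ ≤ 1 / 2 := by
    intro t ht
    have hd : IntegrableOn (fun s => ‖A s - A₀ s‖) (Set.Icc a b) := (hA.sub hA₀).norm
    have i0 := (IntegrableOn.exp_mul hA₀.norm l t).intervalIntegrable_of_mem ha ht
    calc ∫ s in a..t, Real.exp (-l * (t - s)) * ‖A s‖
        ≤ ∫ s in a..t, (Real.exp (-l * (t - s)) * ‖A₀ s‖ + ‖A s - A₀ s‖) := by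
          refine intervalIntegral.integral_mono_on ht.1
            ((IntegrableOn.exp_mul hA.norm l t).intervalIntegrable_of_mem ha ht)
            (i0.add (hd.intervalIntegrable_of_mem ha ht)) fun s hs => ?_
          have e0 : 0 < Real.exp (-l * (t - s)) := Real.exp_pos _
          have e1 : Real.exp (-l * (t - s)) ≤ 1 := by
            rw [Real.exp_le_one_iff]
            have := mul_nonneg hl0 (sub_nonneg.2 hs.2)
            linarith
          have h1 : ‖A s‖ - ‖A₀ s‖ ≤ ‖A s - A₀ s‖ := norm_sub_norm_le _ _
          nlinarith [norm_nonneg (A s - A₀ s)]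
      _ = (∫ s in a..t, Real.exp (-l * (t - s)) * ‖A₀ s‖) + ∫ s in a..t, ‖A s - A₀ s‖ :=
          intervalIntegral.integral_add i0 (hd.intervalIntegrable_of_mem ha ht)
      _ ≤ 1 / 4 + 1 / 4 := by
          refine add_le_add (hl t ht) (le_trans ?_ hAA)
          rw [← setIntegral_Icc_eq_intervalIntegral ht.1]
          exact setIntegral_mono_set hd (Eventually.of_forall fun s => norm_nonneg _)
            (Set.Icc_subset_Icc_right ht.2).eventuallyLE
      _ = 1 / 2 := by norm_num
  have hcont : ContinuousOn (fun t => Real.exp (-(l * (t - a))) * ‖z t‖) (Set.Icc a b) :=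
    ContinuousOn.mul (by fun_prop) hz.norm
  -- At a maximum point of the weighted norm the equation gives `N ≤ K + N / 2`, so the integral
  -- term is absorbed and `N ≤ 2 K`.
  obtain ⟨τ, hτ, hmax⟩ := isCompact_Icc.exists_isMaxOn ⟨a, ha⟩ hcont
  set N := Real.exp (-(l * (τ - a))) * ‖z τ‖ with hN
  have hN0 : 0 ≤ N := by positivity
  have hzN : ∀ s ∈ Set.Icc a b, ‖z s‖ ≤ Real.exp (l * (s - a)) * N := fun s hs => by
    have h1 : Real.exp (-(l * (s - a))) * ‖z s‖ ≤ N := hmax hs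
    calc ‖z s‖ = Real.exp (l * (s - a)) * (Real.exp (-(l * (s - a))) * ‖z s‖) := by
          rw [← mul_assoc, ← Real.exp_add]; simp
      _ ≤ _ := by gcongr
  set K := ‖c‖ + ∫ s in Set.Icc a b, ‖h s‖ with hK
  have hzτ : ‖z τ‖ ≤ K + Real.exp (l * (τ - a)) * (1 / 2 * N) := by
    rw [hzz τ hτ, intervalIntegral.integral_sub (hh.intervalIntegrable_of_mem ha hτ)
      ((IntegrableOn.clm_apply hA hz).intervalIntegrable_of_mem ha hτ), ← add_sub_assoc]
    refine (norm_sub_le _ _).trans (add_le_add ((norm_add_le _ _).trans ?_)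
      (norm_integral_clm_apply_le hA hκ hN0 hzN hτ))
    rw [hK]
    gcongr
    refine (intervalIntegral.norm_integral_le_integral_norm hτ.1).trans ?_
    rw [← setIntegral_Icc_eq_intervalIntegral hτ.1]
    exact setIntegral_mono_set hh.norm (Eventually.of_forall fun s => norm_nonneg _)
      (Set.Icc_subset_Icc_right hτ.2).eventuallyLE
  have hK0 : 0 ≤ K := by positivity
  have hNK : N ≤ 2 * K := by
    have e0 : 0 < Real.exp (-(l * (τ - a))) := Real.exp_pos _
    have e1 : Real.exp (-(l * (τ - a))) ≤ 1 := by
      rw [Real.exp_le_one_iff]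
      have := mul_nonneg hl0 (sub_nonneg.2 hτ.1)
      linarith
    have e2 : N ≤ Real.exp (-(l * (τ - a))) * (K + Real.exp (l * (τ - a)) * (1 / 2 * N)) := by
      rw [hN]; gcongr
    have e3 : Real.exp (-(l * (τ - a))) * (K + Real.exp (l * (τ - a)) * (1 / 2 * N)) =
        Real.exp (-(l * (τ - a))) * K + 1 / 2 * N := by
      rw [mul_add, ← mul_assoc, ← Real.exp_add]; simp
    nlinarith
  calc ‖z t‖ ≤ Real.exp (l * (t - a)) * N := hzN t ht
    _ ≤ Real.exp (l * (b - a)) * (2 * K) := by gcongr; exact ht.2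
    _ = _ := by ring

end Volterra

/-! ### The initial value problem and its continuous dependence on data -/

section InitialValueProblem

variable {H E : Type*} [NormedAddCommGroup H] [NormedSpace ℝ H] [FiniteDimensional ℝ H]
  [NormedAddCommGroup E] [NormedSpace ℝ E] [FiniteDimensional ℝ E]
  {a b : ℝ} {p : ℝ≥0∞} {n : ℕ} (L : H →L[ℝ] E →L[ℝ] E)

/-- `y` is a Carathéodory solution on `[a,b]` of `y' + L(A, y) = f`. -/
def IsODESolution (a b : ℝ) (A : ℝ → H) (f y : ℝ → E) : Prop :=
  IsPrimitive a b y fun s => f s - L (A s) (y s)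

variable {L} {A A₀ : ℝ → H} {f f₀ y y₀ z : ℝ → E}

lemma IsODESolution.rhs_mem (hab : a < b) (hp : 1 ≤ p) (hA : MemSobolev n p a b A)
    (hf : MemSobolev n p a b f) (hy : MemSobolev n p a b y) (hc : ContinuousOn y (Set.Icc a b)) :
    MemSobolev n p a b fun s => f s - L (A s) (y s) :=
  hf.sub hab hp (hA.bilin hab hp L hy (.inr hc))

/-- Bootstrap: a solution in `W_p^k` with `k ≤ n` has its derivative `f - L(A, y)` in `W_p^k`, hence
lies in `W_p^{k+1}`. -/
lemma IsODESolution.memSobolev (hab : a < b) (hp : 1 ≤ p) (hA : MemSobolev n p a b A)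
    (hf : MemSobolev n p a b f) (h : IsODESolution L a b A f y) : MemSobolev (n + 1) p a b y := by
  have := FiniteDimensional.complete ℝ E
  have hc := h.continuousOn hab.le
  have key : ∀ k ≤ n + 1, MemSobolev k p a b y := by
    intro k
    induction k with
    | zero => exact fun _ => hc.memLp_restrict_Icc
    | succ k ih =>
      intro hk
      exact IsPrimitive.memSobolev hab h (IsODESolution.rhs_mem hab hp
        (hA.mono hab hp (by omega)) (hf.mono hab hp (by omega)) (ih (by omega)) hc)
  exact key _ le_rfl

lemma exists_isODESolution (hab : a < b) (hA : IntegrableOn A (Set.Icc a b))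
    (hf : IntegrableOn f (Set.Icc a b)) (c : E) :
    ∃ y, y a = c ∧ IsODESolution L a b A f y := by
  have := FiniteDimensional.complete ℝ E
  have := FiniteDimensional.complete ℝ H
  have ha : a ∈ Set.Icc a b := ⟨le_rfl, hab.le⟩
  have hF : IsPrimitive a b (fun t => c + ∫ s in a..t, f s) f :=
    .of_eq_const_add hab.le hf fun t _ => rfl
  have hLA : IntegrableOn (fun s => L (A s)) (Set.Icc a b) := L.integrable_comp hA
  obtain ⟨y, hyc, hy⟩ := exists_continuousOn_eq_sub_integral hab.le hLA (hF.continuousOn hab.le)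
  have hi := IntegrableOn.clm_apply hLA hyc
  refine ⟨y, by simpa using hy a ha, .of_eq_const_add hab.le (c := c) (hf.sub hi) fun t ht => ?_⟩
  rw [hy t ht, intervalIntegral.integral_sub (hf.intervalIntegrable_of_mem ha ht)
    (hi.intervalIntegrable_of_mem ha ht)]
  abel

omit [FiniteDimensional ℝ H] [FiniteDimensional ℝ E] in
-- The difference keeps the coefficient `A`, so that `A - A₀` acts on the fixed function `y₀` and
-- becomes a forcing term that can be made small.
lemma IsODESolution.sub (h : IsODESolution L a b A f y) (h₀ : IsODESolution L a b A₀ f₀ y₀) :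
    IsODESolution L a b A ((f - f₀) - fun s => L ((A - A₀) s) (y₀ s)) (y - y₀) := by
  have h1 : IsPrimitive a b (-y₀) (-fun s => f₀ s - L (A₀ s) (y₀ s)) := by
    refine ⟨h₀.integrableOn.neg, fun t ht => ?_⟩
    simp only [Pi.neg_apply, intervalIntegral.integral_neg]
    rw [IsPrimitive.eq_add h₀ t ht, neg_add]
  have h2 := IsPrimitive.add h h1
  rw [← sub_eq_add_neg] at h2
  refine h2.congr (fun _ _ => rfl) (Eventually.of_forall fun s => ?_)
  simp
  abel

lemma IsODESolution.eqOn (hab : a < b) (hA : IntegrableOn A (Set.Icc a b))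
    (hy : IsODESolution L a b A f y) (hz : IsODESolution L a b A f z) (hyz : y a = z a) :
    Set.EqOn y z (Set.Icc a b) := by
  have := FiniteDimensional.complete ℝ E
  have := FiniteDimensional.complete ℝ H
  have hLA : IntegrableOn (fun s => L (A s)) (Set.Icc a b) := L.integrable_comp hA
  obtain ⟨C, hC0, hC⟩ := exists_forall_norm_le_of_volterra hab.le hLA
  intro t ht
  have hd := hy.sub hz
  have h := hC _ 0 0 (y - z) hLA (by simp) (integrableOn_zero)
    (IsPrimitive.continuousOn hab.le hd) (fun s hs => ?_) t ht
  · have h' : ‖(y - z) t‖ ≤ 0 := by simpa using h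
    exact sub_eq_zero.1 (norm_le_zero_iff.1 h')
  · rw [IsPrimitive.eq_add hd s hs]
    simp [hyz]

omit [NormedSpace ℝ E] [FiniteDimensional ℝ E] in
lemma tendsto_integral_norm_of_tendsto_eLpNorm {ι : Type*} {l : Filter ι} {g : ι → ℝ → E}
    (hp : 1 ≤ p)
    (hg : ∀ᶠ i in l, AEStronglyMeasurable (g i) (volume.restrict (Set.Icc a b)))
    (h : Tendsto (fun i => eLpNorm (g i) p (volume.restrict (Set.Icc a b))) l (𝓝 0)) :
    Tendsto (fun i => ∫ s in Set.Icc a b, ‖g i s‖) l (𝓝 0) := by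
  have h1 : Tendsto (fun i => ∫⁻ s in Set.Icc a b, ‖g i s‖ₑ) l (𝓝 0) := by
    have h2 := ENNReal.Tendsto.mul_const (b := ENNReal.ofReal (b - a) ^ (1 - 1 / p.toReal)) h
      (.inr (ENNReal.rpow_ne_top_of_nonneg (one_sub_one_div_toReal_nonneg hp) (by simp)))
    rw [zero_mul] at h2
    refine tendsto_of_tendsto_of_tendsto_of_le_of_le' tendsto_const_nhds h2
      (Eventually.of_forall fun _ => zero_le) ?_
    filter_upwards [hg] with i hi using lintegral_enorm_Icc_le_eLpNorm hp hi
  have h3 := (ENNReal.tendsto_toReal ENNReal.zero_ne_top).comp h1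
  rw [ENNReal.toReal_zero] at h3
  refine h3.congr' ?_
  filter_upwards [hg] with i hi using (integral_norm_eq_lintegral_enorm hi).symm

omit [FiniteDimensional ℝ E] in
lemma tendsto_eLpNorm_of_tendsto_sobolevNorm {ι : Type*} {l : Filter ι} {g : ι → ℝ → E}
    (hg : Tendsto (fun i => sobolevNorm n p a b (g i)) l (𝓝 0)) :
    Tendsto (fun i => eLpNorm (g i) p (volume.restrict (Set.Icc a b))) l (𝓝 0) :=
  tendsto_of_tendsto_of_tendsto_of_le_of_le tendsto_const_nhds hg (fun _ => zero_le)
    fun _ => eLpNorm_le_sobolevNorm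

/-- Sobolev convergence of the coefficients implies `L_1` convergence, so eventually they fall
within the radius 1/4 around `A₀` and one Volterra constant serves all of them. -/
lemma exists_tendsto_forall_norm_le_of_isODESolution {ι : Type*} {l : Filter ι} (hab : a < b)
    (hp : 1 ≤ p) {A : ι → ℝ → H} {h z : ι → ℝ → E}
    (hA : ∀ᶠ i in l, MemSobolev n p a b (A i)) (hA₀ : MemSobolev n p a b A₀)
    (hAA : Tendsto (fun i => sobolevNorm n p a b (A i - A₀)) l (𝓝 0))
    (hhW : ∀ᶠ i in l, MemSobolev n p a b (h i))
    (hh : Tendsto (fun i => sobolevNorm n p a b (h i)) l (𝓝 0))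
    (hz : ∀ᶠ i in l, IsODESolution L a b (A i) (h i) (z i))
    (hza : Tendsto (fun i => z i a) l (𝓝 0)) :
    ∃ σ : ι → ℝ, Tendsto σ l (𝓝 0) ∧ ∀ᶠ i in l, ∀ t ∈ Set.Icc a b, ‖z i t‖ ≤ σ i := by
  have := FiniteDimensional.complete ℝ E
  have := FiniteDimensional.complete ℝ H
  have hLA₀ : IntegrableOn (fun s => L (A₀ s)) (Set.Icc a b) :=
    L.integrable_comp (hA₀.integrableOn hp)
  obtain ⟨C, hC0, hC⟩ := exists_forall_norm_le_of_volterra hab.le hLA₀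
  have hdA : ∀ᶠ i in l, MemSobolev n p a b (A i - A₀) :=
    hA.mono fun i hi => hi.sub hab hp hA₀
  refine ⟨fun i => C * (‖z i a‖ + ∫ s in Set.Icc a b, ‖h i s‖), ?_, ?_⟩
  · have h2 := tendsto_integral_norm_of_tendsto_eLpNorm hp
      (hhW.mono fun i hi => hi.aestronglyMeasurable) (tendsto_eLpNorm_of_tendsto_sobolevNorm hh)
    simpa using (hza.norm.add h2).const_mul C
  · have h1 : Tendsto (fun i => ‖L‖ * ∫ s in Set.Icc a b, ‖(A i - A₀) s‖) l (𝓝 0) := by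
      have h0 := tendsto_integral_norm_of_tendsto_eLpNorm (g := fun i => A i - A₀) hp
        (hdA.mono fun i hi => hi.aestronglyMeasurable) (tendsto_eLpNorm_of_tendsto_sobolevNorm hAA)
      have h3 := h0.const_mul ‖L‖
      rwa [mul_zero] at h3
    filter_upwards [h1.eventually (gt_mem_nhds (show (0 : ℝ) < 1 / 4 by norm_num)), hA, hdA, hhW, hz]
      with i hi hAi hdi h3 h4
    have hsmall : ∫ s in Set.Icc a b, ‖L (A i s) - L (A₀ s)‖ ≤ 1 / 4 := by
      refine le_trans ?_ hi.le
      rw [← integral_const_mul]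
      refine integral_mono_of_nonneg (Eventually.of_forall fun _ => norm_nonneg _)
        ((hdi.integrableOn hp).norm.const_mul _) (Eventually.of_forall fun s => ?_)
      simp only [← map_sub, Pi.sub_apply]
      exact L.le_opNorm _
    exact hC (fun s => L (A i s)) (z i a) (h i) (z i) (L.integrable_comp (hAi.integrableOn hp))
      hsmall (h3.integrableOn hp) (IsPrimitive.continuousOn hab.le h4) (IsPrimitive.eq_add h4)

/-- Uniform smallness settles order 0, and the equation then transfers smallness from order `k` to
order `k + 1` through the product estimate. The sup bound `σ` is indispensable for the first gain,
where the coefficient may be controlled only in `L_p`. -/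
lemma tendsto_sobolevNorm_of_isODESolution {ι : Type*} {l : Filter ι} (hab : a < b)
    (hp : 1 ≤ p) {A : ι → ℝ → H} {h z : ι → ℝ → E}
    (hA : ∀ᶠ i in l, MemSobolev n p a b (A i)) (hA₀ : MemSobolev n p a b A₀)
    (hAA : Tendsto (fun i => sobolevNorm n p a b (A i - A₀)) l (𝓝 0))
    (hhW : ∀ᶠ i in l, MemSobolev n p a b (h i))
    (hh : Tendsto (fun i => sobolevNorm n p a b (h i)) l (𝓝 0))
    (hz : ∀ᶠ i in l, IsODESolution L a b (A i) (h i) (z i))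
    (hza : Tendsto (fun i => z i a) l (𝓝 0)) :
    Tendsto (fun i => sobolevNorm (n + 1) p a b (z i)) l (𝓝 0) := by
  have := FiniteDimensional.complete ℝ E
  obtain ⟨σ, hσ, hσz⟩ := exists_tendsto_forall_norm_le_of_isODESolution hab hp hA hA₀ hAA hhW hh hz hza
  have hPC : ∀ k, productConst p a b ‖L‖ₑ k ≠ ∞ := fun k => productConst_ne_top hab hp enorm_ne_top
  have hsup : ∀ᶠ i in l, ∀ t ∈ Set.Icc a b, ‖z i t‖ₑ ≤ ENNReal.ofReal (σ i) := by
    filter_upwards [hσz] with i hi t ht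
    rw [← ofReal_norm]
    exact ENNReal.ofReal_le_ofReal (hi t ht)
  have hσ' : Tendsto (fun i => ENNReal.ofReal (σ i)) l (𝓝 0) := by
    simpa using ENNReal.tendsto_ofReal hσ
  have hz0 : Tendsto (fun i => eLpNorm (z i) p (volume.restrict (Set.Icc a b))) l (𝓝 0) := by
    have h1 := ENNReal.Tendsto.const_mul (a := volume.restrict (Set.Icc a b) Set.univ ^ p.toReal⁻¹)
      hσ' (.inr (ENNReal.rpow_ne_top_of_nonneg (by positivity) (by simp)))
    rw [mul_zero] at h1
    refine tendsto_of_tendsto_of_tendsto_of_le_of_le' tendsto_const_nhds h1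
      (Eventually.of_forall fun _ => zero_le) ?_
    filter_upwards [hσz] with i hi
    exact eLpNorm_le_of_ae_bound ((ae_restrict_mem measurableSet_Icc).mono hi)
  have key : ∀ k ≤ n + 1, Tendsto (fun i => sobolevNorm k p a b (z i)) l (𝓝 0) := by
    intro k
    induction k with
    | zero => intro _; simpa only [sobolevNorm_zero] using hz0
    | succ k ih =>
      intro hk
      have hk' : k ≤ n := by omega
      have h1 : Tendsto (fun i => eLpNorm (z i) p (volume.restrict (Set.Icc a b)) +
          (sobolevNorm n p a b (h i) + productConst p a b ‖L‖ₑ k *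
            ((sobolevNorm n p a b (A i - A₀) + sobolevNorm n p a b A₀) *
              (ENNReal.ofReal (σ i) + sobolevNorm k p a b (z i))))) l (𝓝 0) := by
        have h2 := (hAA.add_const (sobolevNorm n p a b A₀))
        have h3 := hσ'.add (ih (by omega))
        rw [add_zero] at h3
        have h4 := ENNReal.Tendsto.mul h2 (.inr ENNReal.zero_ne_top) h3
          (.inr (by simpa using (hA₀.sobolevNorm_lt_top hab).ne))
        have h5 := hz0.add (hh.add (ENNReal.Tendsto.const_mul h4 (.inr (hPC k))))
        simpa using h5
      refine tendsto_of_tendsto_of_tendsto_of_le_of_le' tendsto_const_nhds h1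
        (Eventually.of_forall fun _ => zero_le) ?_
      filter_upwards [hA, hhW, hz, hsup] with i hAi hhi hzi hsi
      have hAk := hAi.mono hab hp hk'
      have hhk := hhi.mono hab hp hk'
      have hzk := (hzi.memSobolev hab hp hAi hhi).mono hab hp (show k ≤ n + 1 by omega)
      have hzc := IsPrimitive.continuousOn hab.le hzi
      have hprod := hAk.bilin hab hp L hzk (.inr hzc)
      rw [IsPrimitive.sobolevNorm_succ hab hzi (IsODESolution.rhs_mem hab hp hAk hhk hzk hzc)]
      gcongr
      refine (hhk.sobolevNorm_sub_le hab hp hprod).trans ?_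
      gcongr
      · exact sobolevNorm_mono hk'
      · refine (hAk.sobolevNorm_bilin_le hab hp L hzk hsi).trans ?_
        gcongr
        calc sobolevNorm k p a b (A i) ≤ sobolevNorm n p a b (A i) := sobolevNorm_mono hk'
          _ = sobolevNorm n p a b ((A i - A₀) + A₀) := by rw [sub_add_cancel]
          _ ≤ _ := (hAi.sub hab hp hA₀).sobolevNorm_add_le hab hp hA₀
  exact key _ le_rfl

/-- Solutions of the initial value problem depend continuously, in `W_p^{n+1}`, on the coefficient
and on the right-hand side in `W_p^n` and on the initial value. -/
lemma tendsto_sobolevNorm_sub_of_isODESolution {ι : Type*} {l : Filter ι} (hab : a < b) (hp : 1 ≤ p)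
    {A : ι → ℝ → H} {f y : ι → ℝ → E}
    (hA : ∀ᶠ i in l, MemSobolev n p a b (A i)) (hA₀ : MemSobolev n p a b A₀)
    (hAA : Tendsto (fun i => sobolevNorm n p a b (A i - A₀)) l (𝓝 0))
    (hf : ∀ᶠ i in l, MemSobolev n p a b (f i)) (hf₀ : MemSobolev n p a b f₀)
    (hff : Tendsto (fun i => sobolevNorm n p a b (f i - f₀)) l (𝓝 0))
    (hy : ∀ᶠ i in l, IsODESolution L a b (A i) (f i) (y i))
    (hy₀ : IsODESolution L a b A₀ f₀ y₀) (hya : Tendsto (fun i => y i a) l (𝓝 (y₀ a))) :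
    Tendsto (fun i => sobolevNorm (n + 1) p a b (y i - y₀)) l (𝓝 0) := by
  have hyW₀ := hy₀.memSobolev hab hp hA₀ hf₀
  have hyn₀ := hyW₀.of_succ hab hp
  have hyc₀ := hyW₀.continuousOn
  set Z := embeddingConst p a b * sobolevNorm (n + 1) p a b y₀ + sobolevNorm n p a b y₀ with hZdef
  have hZ : Z ≠ ∞ := ENNReal.add_ne_top.2 ⟨ENNReal.mul_ne_top (embeddingConst_ne_top hab hp)
    (hyW₀.sobolevNorm_lt_top hab).ne, (hyn₀.sobolevNorm_lt_top hab).ne⟩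
  have hLAy : ∀ᶠ i in l, MemSobolev n p a b (fun s => L ((A i - A₀) s) (y₀ s)) := by
    filter_upwards [hA] with i hAi
    exact (hAi.sub hab hp hA₀).bilin hab hp L hyn₀ (.inr hyc₀)
  refine tendsto_sobolevNorm_of_isODESolution
    (h := fun i => (f i - f₀) - fun s => L ((A i - A₀) s) (y₀ s)) hab hp hA hA₀ hAA ?_ ?_
    (hy.mono fun i hi => hi.sub hy₀) ?_
  · filter_upwards [hf, hLAy] with i hfi hi using (hfi.sub hab hp hf₀).sub hab hp hi
  · have h1 : Tendsto (fun i => sobolevNorm n p a b (f i - f₀) +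
        productConst p a b ‖L‖ₑ n * (sobolevNorm n p a b (A i - A₀) * Z)) l (𝓝 0) := by
      have := hff.add (ENNReal.Tendsto.const_mul (ENNReal.Tendsto.mul_const hAA (.inr hZ))
        (.inr (productConst_ne_top (n := n) hab hp (enorm_ne_top (x := L)))))
      simpa using this
    refine tendsto_of_tendsto_of_tendsto_of_le_of_le' tendsto_const_nhds h1
      (Eventually.of_forall fun _ => zero_le) ?_
    filter_upwards [hA, hf, hLAy] with i hAi hfi hi
    refine ((hfi.sub hab hp hf₀).sobolevNorm_sub_le hab hp hi).trans ?_
    gcongr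
    exact (hAi.sub hab hp hA₀).sobolevNorm_bilin_le hab hp L hyn₀
      fun t ht => hyW₀.enorm_le hab hp ht
  · simpa using hya.sub_const (y₀ a)

end InitialValueProblem

/-! ### Increments of derivatives along convergent families -/

section Derivatives

variable {E : Type*} [NormedAddCommGroup E] [NormedSpace ℝ E]
  {a b : ℝ} {p : ℝ≥0∞} {n k l : ℕ} {y z g y₀ : ℝ → E}

lemma MemSobolev.iteratedDerivWithin_mem (hab : a < b) (hy : MemSobolev (k + l) p a b y) :
    MemSobolev k p a b (iteratedDerivWithin l y (Set.Icc a b)) := by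
  induction l generalizing y with
  | zero => simpa using hy
  | succ l ih =>
    rw [iteratedDerivWithin_succ']
    exact ih (MemSobolev.derivWithin_mem hab hy)

lemma sobolevNorm_iteratedDerivWithin_le :
    sobolevNorm k p a b (iteratedDerivWithin l y (Set.Icc a b)) ≤ sobolevNorm (k + l) p a b y := by
  induction l generalizing y with
  | zero => simp
  | succ l ih =>
    rw [iteratedDerivWithin_succ', ← add_assoc, sobolevNorm_succ_derivWithin]
    exact ih.trans le_add_self

lemma MemSobolev.iteratedDerivWithin_sub (hab : a < b) (hy : MemSobolev (n + 1) p a b y)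
    (hz : MemSobolev (n + 1) p a b z) (hl : l ≤ n) {t : ℝ} (ht : t ∈ Set.Icc a b) :
    iteratedDerivWithin l (y - z) (Set.Icc a b) t =
      iteratedDerivWithin l y (Set.Icc a b) t - iteratedDerivWithin l z (Set.Icc a b) t :=
  _root_.iteratedDerivWithin_sub ht (uniqueDiffOn_Icc hab)
    ((hy.1.of_le (by exact_mod_cast hl)) t ht) ((hz.1.of_le (by exact_mod_cast hl)) t ht)

lemma MemSobolev.iteratedDerivWithin_add (hab : a < b) (hy : MemSobolev (n + 1) p a b y)
    (hz : MemSobolev (n + 1) p a b z) (hl : l ≤ n) {t : ℝ} (ht : t ∈ Set.Icc a b) :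
    iteratedDerivWithin l (y + z) (Set.Icc a b) t =
      iteratedDerivWithin l y (Set.Icc a b) t + iteratedDerivWithin l z (Set.Icc a b) t :=
  _root_.iteratedDerivWithin_add ht (uniqueDiffOn_Icc hab)
    ((hy.1.of_le (by exact_mod_cast hl)) t ht) ((hz.1.of_le (by exact_mod_cast hl)) t ht)

lemma IsPrimitive.enorm_sub_le_eLpNorm (hp : 1 ≤ p) (h : IsPrimitive a b y g) {s t : ℝ}
    (hs : s ∈ Set.Icc a b) (ht : t ∈ Set.Icc a b) :
    ‖y t - y s‖ₑ ≤ eLpNorm g p (volume.restrict (Set.uIcc s t)) *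
      ENNReal.ofReal |t - s| ^ (1 - 1 / p.toReal) := by
  wlog hst : s ≤ t generalizing s t
  · rw [← enorm_neg, neg_sub, Set.uIcc_comm, abs_sub_comm]
    exact this ht hs (le_of_not_ge hst)
  rw [Set.uIcc_of_le hst, abs_of_nonneg (sub_nonneg.2 hst)]
  exact (h.enorm_sub_le hs ht hst).trans (lintegral_enorm_Icc_le_eLpNorm hp
    (h.integrableOn.mono_set (Set.Icc_subset_Icc hs.1 ht.2)).aestronglyMeasurable)

variable [FiniteDimensional ℝ E]

/-- The top continuous derivative of a function in `W_p^{n+1}` has vanishing Hölder seminorm, with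
exponent `1/p'`, on short intervals. -/
lemma MemSobolev.exists_forall_enorm_sub_le (hab : a < b) (hp : 1 ≤ p) (hp' : p ≠ ∞)
    (hy : MemSobolev 1 p a b y) {η : ℝ} (hη : 0 < η) :
    ∃ δ > 0, ∀ s ∈ Set.Icc a b, ∀ t ∈ Set.Icc a b, |t - s| < δ →
      ‖y t - y s‖ₑ ≤ ENNReal.ofReal η * ENNReal.ofReal |t - s| ^ (1 - 1 / p.toReal) := by
  obtain ⟨g, hg, h⟩ := hy.exists_isPrimitive hab hp
  -- The `L_p` norm is absolutely continuous with respect to the measure of the set; this fails for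
  -- `p = ∞`.
  obtain ⟨δ, hδ, H⟩ := MemLp.eLpNorm_indicator_le hp hp' hg hη
  refine ⟨δ, hδ, fun s hs t ht hst => (h.enorm_sub_le_eLpNorm hp hs ht).trans ?_⟩
  gcongr
  have hsub := Set.uIcc_subset_Icc hs ht
  have := H (Set.uIcc s t) measurableSet_uIcc ?_
  · rwa [eLpNorm_indicator_eq_eLpNorm_restrict measurableSet_uIcc,
      Measure.restrict_restrict_of_subset hsub] at this
  · refine (Measure.restrict_apply_le _ _).trans ?_
    rw [Real.volume_interval]
    exact ENNReal.ofReal_le_ofReal hst.le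

variable {ι : Type*} {F : Filter ι} {Y : ι → ℝ → E}

lemma exists_tendsto_forall_norm_iteratedDerivWithin_sub_le (hab : a < b) (hp : 1 ≤ p)
    (hY : ∀ᶠ i in F, MemSobolev (n + 1) p a b (Y i)) (hy₀ : MemSobolev (n + 1) p a b y₀)
    (h : Tendsto (fun i => sobolevNorm (n + 1) p a b (Y i - y₀)) F (𝓝 0)) (hl : l ≤ n) :
    ∃ σ : ι → ℝ, Tendsto σ F (𝓝 0) ∧ ∀ᶠ i in F, ∀ t ∈ Set.Icc a b,
      ‖iteratedDerivWithin l (Y i) (Set.Icc a b) t - iteratedDerivWithin l y₀ (Set.Icc a b) t‖ ≤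
        σ i := by
  have he := embeddingConst_ne_top hab hp
  have h1 := ENNReal.Tendsto.const_mul h (.inr he)
  rw [mul_zero] at h1
  have h2 := (ENNReal.tendsto_toReal ENNReal.zero_ne_top).comp h1
  rw [ENNReal.toReal_zero] at h2
  refine ⟨_, h2, ?_⟩
  obtain ⟨k, rfl⟩ := Nat.exists_eq_add_of_le' hl
  filter_upwards [hY] with i hi t ht
  have hd := hi.sub hab hp hy₀
  have hd' : MemSobolev (k + 1 + l) p a b (Y i - y₀) := by
    convert hd using 1; omega
  have h3 := (hd'.iteratedDerivWithin_mem hab).enorm_le hab hp ht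
  rw [hi.iteratedDerivWithin_sub hab hy₀ hl ht] at h3
  rw [← toReal_enorm]
  refine ENNReal.toReal_mono (ENNReal.mul_ne_top he (hd.sobolevNorm_lt_top hab).ne)
    (h3.trans (mul_le_mul' le_rfl ?_))
  refine sobolevNorm_iteratedDerivWithin_le.trans (le_of_eq ?_)
  congr 1; omega

lemma exists_forall_norm_iteratedDerivWithin_le (hab : a < b) (hp : 1 ≤ p)
    (hY : ∀ᶠ i in F, MemSobolev (n + 1) p a b (Y i)) (hy₀ : MemSobolev (n + 1) p a b y₀)
    (h : Tendsto (fun i => sobolevNorm (n + 1) p a b (Y i - y₀)) F (𝓝 0)) (hl : l ≤ n) :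
    ∃ K : ℝ, 0 ≤ K ∧ ∀ᶠ i in F, ∀ t ∈ Set.Icc a b,
      ‖iteratedDerivWithin l (Y i) (Set.Icc a b) t‖ ≤ K := by
  obtain ⟨σ, hσ, H⟩ := exists_tendsto_forall_norm_iteratedDerivWithin_sub_le hab hp hY hy₀ h hl
  have hc : ContinuousOn (iteratedDerivWithin l y₀ (Set.Icc a b)) (Set.Icc a b) :=
    hy₀.1.continuousOn_iteratedDerivWithin (by exact_mod_cast hl) (uniqueDiffOn_Icc hab)
  obtain ⟨K, hK⟩ := isCompact_Icc.exists_bound_of_continuousOn hc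
  refine ⟨|K| + 1, by positivity, ?_⟩
  filter_upwards [H, hσ.eventually (gt_mem_nhds one_pos)] with i hi h1 t ht
  have e : iteratedDerivWithin l (Y i) (Set.Icc a b) t = iteratedDerivWithin l y₀ (Set.Icc a b) t +
    (iteratedDerivWithin l (Y i) (Set.Icc a b) t - iteratedDerivWithin l y₀ (Set.Icc a b) t) := by
    abel
  rw [e]
  exact (norm_add_le _ _).trans (add_le_add ((hK t ht).trans (le_abs_self K)) ((hi t ht).trans h1.le))

/-- Below the top order the next derivative is continuous and uniformly bounded, so the mean value
inequality applies. This is the estimate to be paired with (γ'). -/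
lemma exists_forall_norm_iteratedDerivWithin_sub_le_mul (hab : a < b) (hp : 1 ≤ p)
    (hY : ∀ᶠ i in F, MemSobolev (n + 1) p a b (Y i)) (hy₀ : MemSobolev (n + 1) p a b y₀)
    (h : Tendsto (fun i => sobolevNorm (n + 1) p a b (Y i - y₀)) F (𝓝 0)) (hl : l < n) :
    ∃ K : ℝ, 0 ≤ K ∧ ∀ᶠ i in F, ∀ s ∈ Set.Icc a b, ∀ t ∈ Set.Icc a b,
      ‖iteratedDerivWithin l (Y i) (Set.Icc a b) t - iteratedDerivWithin l (Y i) (Set.Icc a b) s‖ ≤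
        K * |t - s| := by
  obtain ⟨K, hK0, hK⟩ := exists_forall_norm_iteratedDerivWithin_le hab hp hY hy₀ h
    (Nat.succ_le_of_lt hl)
  refine ⟨K, hK0, ?_⟩
  filter_upwards [hY, hK] with i hi hKi s hs t ht
  refine (convex_Icc a b).norm_image_sub_le_of_norm_derivWithin_le
    (hi.1.differentiableOn_iteratedDerivWithin (by exact_mod_cast hl) (uniqueDiffOn_Icc hab))
    (fun u hu => ?_) hs ht
  rw [← iteratedDerivWithin_succ]
  exact hKi u hu

/-- Split `Y i` as `(Y i - y₀) + y₀`. The Hölder seminorm of the first part is at most its Sobolev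
norm, which tends to 0; that of the second is small on short intervals. The resulting factor `η`
turns the `O(1)` in (γ_p) into convergence to 0. -/
lemma eventually_forall_norm_iteratedDerivWithin_sub_le_rpow (hab : a < b) (hp : 1 ≤ p)
    (hp' : p ≠ ∞)
    (hY : ∀ᶠ i in F, MemSobolev (n + 1) p a b (Y i)) (hy₀ : MemSobolev (n + 1) p a b y₀)
    (h : Tendsto (fun i => sobolevNorm (n + 1) p a b (Y i - y₀)) F (𝓝 0)) {η : ℝ} (hη : 0 < η) :
    ∃ δ > 0, ∀ᶠ i in F, ∀ s ∈ Set.Icc a b, ∀ t ∈ Set.Icc a b, |t - s| < δ →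
      ‖iteratedDerivWithin n (Y i) (Set.Icc a b) t - iteratedDerivWithin n (Y i) (Set.Icc a b) s‖ ≤
        η * |t - s| ^ (1 - 1 / p.toReal) := by
  have h01 : ∀ {u : ℝ → E}, MemSobolev (n + 1) p a b u →
      MemSobolev 1 p a b (iteratedDerivWithin n u (Set.Icc a b)) := fun hu =>
    MemSobolev.iteratedDerivWithin_mem hab (by rwa [add_comm])
  obtain ⟨δ, hδ, H⟩ := (h01 hy₀).exists_forall_enorm_sub_le hab hp hp' (half_pos hη)
  have hη2 : (0 : ℝ≥0∞) < ENNReal.ofReal (η / 2) := by simpa using hη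
  refine ⟨δ, hδ, ?_⟩
  filter_upwards [hY, h.eventually (gt_mem_nhds hη2)] with i hi hsm s hs t ht hst
  have hd := hi.sub hab hp hy₀
  obtain ⟨g, hg, hgp⟩ := (h01 hd).exists_isPrimitive hab hp
  set V := ENNReal.ofReal |t - s| ^ (1 - 1 / p.toReal) with hV
  have h1 : ‖iteratedDerivWithin n (Y i - y₀) (Set.Icc a b) t -
      iteratedDerivWithin n (Y i - y₀) (Set.Icc a b) s‖ₑ ≤ ENNReal.ofReal (η / 2) * V := by
    refine (hgp.enorm_sub_le_eLpNorm hp hs ht).trans ?_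
    rw [← hV]
    gcongr
    refine (eLpNorm_mono_measure g (Measure.restrict_mono (Set.uIcc_subset_Icc hs ht) le_rfl)).trans
      (le_trans ?_ hsm.le)
    calc _ ≤ sobolevNorm 1 p a b (iteratedDerivWithin n (Y i - y₀) (Set.Icc a b)) := by
          rw [hgp.sobolevNorm_succ hab hg, sobolevNorm_zero]; exact le_add_self
      _ ≤ sobolevNorm (1 + n) p a b (Y i - y₀) := sobolevNorm_iteratedDerivWithin_le
      _ = _ := by rw [add_comm]
  have h2 := H s hs t ht hst
  rw [hi.iteratedDerivWithin_sub hab hy₀ le_rfl ht, hi.iteratedDerivWithin_sub hab hy₀ le_rfl hs]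
    at h1
  have h3 : ‖iteratedDerivWithin n (Y i) (Set.Icc a b) t -
      iteratedDerivWithin n (Y i) (Set.Icc a b) s‖ₑ ≤
      ENNReal.ofReal (η * |t - s| ^ (1 - 1 / p.toReal)) := by
    calc _ = ‖((iteratedDerivWithin n (Y i) (Set.Icc a b) t - iteratedDerivWithin n y₀ (Set.Icc a b) t)
          - (iteratedDerivWithin n (Y i) (Set.Icc a b) s - iteratedDerivWithin n y₀ (Set.Icc a b) s))
          + (iteratedDerivWithin n y₀ (Set.Icc a b) t -
            iteratedDerivWithin n y₀ (Set.Icc a b) s)‖ₑ := by congr 1; abel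
      _ ≤ ENNReal.ofReal (η / 2) * V + ENNReal.ofReal (η / 2) * V :=
          (enorm_add_le _ _).trans (add_le_add h1 h2)
      _ = ENNReal.ofReal η * V := by
          rw [← add_mul, ← ENNReal.ofReal_add (by positivity) (by positivity), add_halves]
      _ = _ := by
          rw [hV, ENNReal.ofReal_rpow_of_nonneg (abs_nonneg _) (one_sub_one_div_toReal_nonneg hp),
            ENNReal.ofReal_mul hη.le]
  rw [← ofReal_norm, ENNReal.ofReal_le_ofReal_iff (by positivity)] at h3
  exact h3

end Derivatives

/-! ### Convergence of the multipoint operators -/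

section Multipoint

variable {m : ℕ}

/-- Continuous real bilinear maps between normed spaces, with the topologies given by the norms. -/
abbrev BilinCLM (H E G : Type*) [NormedAddCommGroup H] [NormedSpace ℝ H] [NormedAddCommGroup E]
    [NormedSpace ℝ E] [NormedAddCommGroup G] [NormedSpace ℝ G] : Type _ := H →L[ℝ] E →L[ℝ] G

/-- Matrix-vector multiplication as a continuous real bilinear map. -/
noncomputable def mulVecCLM (m : ℕ) :
    BilinCLM (Matrix (Fin m) (Fin m) ℂ) (Fin m → ℂ) (Fin m → ℂ) :=
  LinearMap.mkContinuous₂ (Matrix.mulVecBilin ℝ ℝ) 1 fun A v => by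
    simpa using Matrix.linfty_opNorm_mulVec A v

@[simp]
lemma mulVecCLM_apply (A : Matrix (Fin m) (Fin m) ℂ) (v : Fin m → ℂ) :
    mulVecCLM m A v = A *ᵥ v := rfl

lemma Filter.Tendsto.mulVec {ι : Type*} {F : Filter ι} {A : ι → Matrix (Fin m) (Fin m) ℂ}
    {A₀ : Matrix (Fin m) (Fin m) ℂ} {v : ι → Fin m → ℂ} {v₀ : Fin m → ℂ}
    (hA : Tendsto A F (𝓝 A₀)) (hv : Tendsto v F (𝓝 v₀)) :
    Tendsto (fun i => A i *ᵥ v i) F (𝓝 (A₀ *ᵥ v₀)) :=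
  ((mulVecCLM m).isBoundedBilinearMap.continuous.tendsto (A₀, v₀)).comp (hA.prodMk_nhds hv)

/-- Compare every value with a common one `v'`: only the sums of the matrices converge, while the
sums of their norms may be unbounded, so the norms may appear only against the increments `v - v'`.
-/
lemma tendsto_sum_mulVec {ι κ : Type*} {F : Filter ι} {K : ι → Finset κ}
    {β : ι → κ → Matrix (Fin m) (Fin m) ℂ} {β₀ : Matrix (Fin m) (Fin m) ℂ}
    {v : ι → κ → Fin m → ℂ} {v' : ι → Fin m → ℂ} {v₀ : Fin m → ℂ}
    (hβ : Tendsto (fun i => ∑ k ∈ K i, β i k) F (𝓝 β₀)) (hv : Tendsto v' F (𝓝 v₀))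
    (h : Tendsto (fun i => ∑ k ∈ K i, ‖β i k‖ * ‖v i k - v' i‖) F (𝓝 0)) :
    Tendsto (fun i => ∑ k ∈ K i, β i k *ᵥ v i k) F (𝓝 (β₀ *ᵥ v₀)) := by
  have e : ∀ i, ∑ k ∈ K i, β i k *ᵥ v i k =
      ∑ k ∈ K i, β i k *ᵥ (v i k - v' i) + (∑ k ∈ K i, β i k) *ᵥ v' i := fun i => by
    rw [Matrix.sum_mulVec, ← Finset.sum_add_distrib]
    simp [Matrix.mulVec_sub]
  simp only [e]
  rw [← zero_add (β₀ *ᵥ v₀)]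
  refine Tendsto.add (squeeze_zero_norm (fun i => ?_) h) ?_
  · exact (norm_sum_le _ _).trans (Finset.sum_le_sum fun k _ => Matrix.linfty_opNorm_mulVec _ _)
  · exact hβ.mulVec hv

/-- The multipoint operators converge to the limiting operator along convergent arguments. -/
lemma tendsto_multipointOp {n r : ℕ} {p : ℝ≥0∞} (hp1 : 1 ≤ p) (hp : p ≠ ∞)
    {a b : ℝ} (hab : a < b) {ω : ℕ → ℝ → ℕ} {β : ℕ → ℕ → ℕ → ℝ → Matrix (Fin m) (Fin m) ℂ}
    {t : ℕ → ℕ → ℝ → ℝ}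
    (ht : ∀ᶠ ε in 𝓝[>] (0 : ℝ), ∀ j ∈ Finset.range (r + 1), ∀ k ∈ Finset.Icc 1 (ω j ε),
      t j k ε ∈ Set.Icc a b)
    {β₀ : ℕ → ℕ → Matrix (Fin m) (Fin m) ℂ} {t₀ : ℕ → ℝ}
    (ht₀ : ∀ j ∈ Finset.Icc 1 r, t₀ j ∈ Set.Icc a b)
    (hα : CondAlpha r ω t t₀) (hβ : CondBeta (n + 1) r ω β β₀)
    (hγp : CondGammaP (n + 1) r p ω β t t₀) (hγ' : CondGamma' (n + 1) r ω β t t₀)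
    (hδ : CondDelta (n + 1) ω β)
    {Y : ℝ → ℝ → Fin m → ℂ} {y₀ : ℝ → Fin m → ℂ}
    (hY : ∀ᶠ ε in 𝓝[>] (0 : ℝ), MemSobolev (n + 1) p a b (Y ε)) (hy₀ : MemSobolev (n + 1) p a b y₀)
    (h : Tendsto (fun ε => sobolevNorm (n + 1) p a b (Y ε - y₀)) (𝓝[>] (0 : ℝ)) (𝓝 0)) :
    Tendsto (fun ε => multipointOp (n + 1) r a b ω β t ε (Y ε)) (𝓝[>] (0 : ℝ))
      (𝓝 (limitMultipointOp (n + 1) r a b β₀ t₀ y₀)) := by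
  have hr : Finset.range (r + 1) = insert 0 (Finset.Icc 1 r) := by ext; simp; omega
  have hr0 : 0 ∉ Finset.Icc 1 r := by simp
  simp only [multipointOp, limitMultipointOp]
  have e : ∀ ε j, ∑ k ∈ Finset.Icc 1 (ω j ε), ∑ l ∈ Finset.range (n + 1),
      β j k l ε *ᵥ iteratedDerivWithin l (Y ε) (Set.Icc a b) (t j k ε) =
      ∑ l ∈ Finset.range (n + 1), ∑ k ∈ Finset.Icc 1 (ω j ε),
      β j k l ε *ᵥ iteratedDerivWithin l (Y ε) (Set.Icc a b) (t j k ε) :=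
    fun ε j => Finset.sum_comm
  simp only [e]
  -- The block `j = 0` has no limiting point; it vanishes by (δ) and boundedness of the derivatives.
  simp only [hr, Finset.sum_insert hr0]
  rw [← zero_add (Finset.sum (Finset.Icc 1 r) _)]
  apply Tendsto.add
  · rw [show (0 : Fin m → ℂ) = ∑ _l ∈ Finset.range (n + 1), 0 by simp]
    refine tendsto_finsetSum _ fun l hl => ?_
    obtain ⟨K, hK0, hK⟩ := exists_forall_norm_iteratedDerivWithin_le hab hp1 hY hy₀ h
      (Nat.lt_succ_iff.1 (Finset.mem_range.1 hl))
    have h1 := (hδ l hl).const_mul K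
    rw [mul_zero] at h1
    refine squeeze_zero_norm' ?_ h1
    filter_upwards [ht, hK] with ε htε hKε
    rw [Finset.mul_sum]
    refine (norm_sum_le _ _).trans (Finset.sum_le_sum fun k hk => ?_)
    refine (Matrix.linfty_opNorm_mulVec _ _).trans ?_
    rw [mul_comm]
    gcongr
    exact hKε _ (htε 0 (by simp) k hk)
  · refine tendsto_finsetSum _ fun j hj => tendsto_finsetSum _ fun l hl => ?_
    have hjr : j ∈ Finset.range (r + 1) := by simp at hj ⊢; omega
    have hln := Nat.lt_succ_iff.1 (Finset.mem_range.1 hl)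
    refine tendsto_sum_mulVec (v' := fun ε => iteratedDerivWithin l (Y ε) (Set.Icc a b) (t₀ j))
      (hβ j hj l hl) ?_ ?_
    · obtain ⟨σ, hσ, H⟩ :=
        exists_tendsto_forall_norm_iteratedDerivWithin_sub_le hab hp1 hY hy₀ h hln
      rw [tendsto_iff_norm_sub_tendsto_zero]
      refine squeeze_zero' (Eventually.of_forall fun _ => norm_nonneg _) ?_ hσ
      filter_upwards [H] with ε hε using hε _ (ht₀ j hj)
    -- Orders below the top use the Lipschitz bound and (γ'); the top order uses the small Hölder
    -- bound and (γ_p).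
    rcases hln.lt_or_eq with hlt | rfl
    · obtain ⟨K, hK0, hK⟩ :=
        exists_forall_norm_iteratedDerivWithin_sub_le_mul hab hp1 hY hy₀ h hlt
      have h1 := (hγ' j hj l (by simpa using hlt)).const_mul K
      rw [mul_zero] at h1
      refine squeeze_zero' (Eventually.of_forall fun _ =>
        Finset.sum_nonneg fun _ _ => by positivity) ?_ h1
      filter_upwards [ht, hK] with ε htε hKε
      rw [Finset.mul_sum]
      refine Finset.sum_le_sum fun k hk => ?_
      calc _ ≤ ‖β j k l ε‖ * (K * |t j k ε - t₀ j|) := by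
            gcongr; exact hKε _ (ht₀ j hj) _ (htε j hjr k hk)
        _ = _ := by ring
    · obtain ⟨C, hC0, hC⟩ := (hγp j hj).exists_pos
      have hC' := hC.bound
      rw [Metric.tendsto_nhds]
      intro η hη
      -- With `C` the bound from (γ_p), this makes the sum at most `η / 2`.
      have hη' : 0 < η / (2 * C) := by positivity
      obtain ⟨δ, hδ0, H⟩ :=
        eventually_forall_norm_iteratedDerivWithin_sub_le_rpow hab hp1 hp hY hy₀ h hη'
      filter_upwards [ht, H, hα j hj δ hδ0, hC'] with ε htε hHε hαε hCε
      have hnn : 0 ≤ ∑ k ∈ Finset.Icc 1 (ω j ε), ‖β j k l ε‖ *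
          ‖iteratedDerivWithin l (Y ε) (Set.Icc a b) (t j k ε) -
            iteratedDerivWithin l (Y ε) (Set.Icc a b) (t₀ j)‖ :=
        Finset.sum_nonneg fun _ _ => by positivity
      rw [Real.dist_eq, sub_zero, abs_of_nonneg hnn]
      simp only [Nat.add_sub_cancel, norm_one, mul_one] at hCε
      calc _ ≤ ∑ k ∈ Finset.Icc 1 (ω j ε), η / (2 * C) * (‖β j k l ε‖ *
            |t j k ε - t₀ j| ^ (1 - 1 / p.toReal)) := by
            refine Finset.sum_le_sum fun k hk => ?_
            rw [mul_left_comm]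
            gcongr
            exact hHε _ (ht₀ j hj) _ (htε j hjr k hk) (hαε k hk)
        _ = η / (2 * C) * ∑ k ∈ Finset.Icc 1 (ω j ε), ‖β j k l ε‖ *
            |t j k ε - t₀ j| ^ (1 - 1 / p.toReal) := by rw [Finset.mul_sum]
        _ ≤ η / (2 * C) * C := by gcongr; exact (le_abs_self _).trans hCε
        _ = η / 2 := by field_simp
        _ < η := half_lt_self hη

end Multipoint

/-! ### Boundary value problems and superposition -/

section BoundaryValueProblem

variable {m n r : ℕ} {p : ℝ≥0∞} {a b : ℝ}

lemma tendsto_inv_mulVec {ι : Type*} {F : Filter ι} {M : ι → Matrix (Fin m) (Fin m) ℂ}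
    {M₀ : Matrix (Fin m) (Fin m) ℂ} (hM : Tendsto M F (𝓝 M₀)) (hdet : IsUnit M₀)
    {d : ι → Fin m → ℂ} {d₀ : Fin m → ℂ} (hd : Tendsto d F (𝓝 d₀)) :
    Tendsto (fun i => (M i)⁻¹ *ᵥ d i) F (𝓝 (M₀⁻¹ *ᵥ d₀)) := by
  refine Tendsto.mulVec ?_ hd
  obtain ⟨u, rfl⟩ := hdet
  simp only [Matrix.nonsing_inv_eq_ringInverse]
  exact (NormedRing.inverse_continuousAt u).tendsto.comp hM

lemma Matrix.tendsto_of_tendsto_apply {ι : Type*} {F : Filter ι}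
    {M : ι → Matrix (Fin m) (Fin m) ℂ} {M₀ : Matrix (Fin m) (Fin m) ℂ}
    (hM : ∀ i, Tendsto (fun x => (M x).col i) F (𝓝 (M₀.col i))) : Tendsto M F (𝓝 M₀) := by
  have h : Continuous ((LinearMap.toContinuousLinearMap
      ((Matrix.ofLinearEquiv ℝ).toLinearMap : (Fin m → Fin m → ℂ) →ₗ[ℝ] Matrix (Fin m) (Fin m) ℂ))) :=
    ContinuousLinearMap.continuous _
  refine (h.tendsto M₀).comp (tendsto_pi_nhds.2 fun i => tendsto_pi_nhds.2 fun j => ?_)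
  exact tendsto_pi_nhds.1 (hM j) i

/-- The pointwise clause for order at least 2 is automatic: `f - A y` is then continuous, so its
primitive is differentiable everywhere. -/
lemma isBVPSolution_iff (hab : a < b) (hp : 1 ≤ p) {A : ℝ → Matrix (Fin m) (Fin m) ℂ}
    {f y : ℝ → Fin m → ℂ} {B : (ℝ → Fin m → ℂ) → Fin m → ℂ} {c : Fin m → ℂ}
    (hA : MemSobolev n p a b A) (hf : MemSobolev n p a b f) :
    IsBVPSolution (n + 1) p a b A f B c y ↔
      IsODESolution (mulVecCLM m) a b A f y ∧ B y = c := by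
  constructor
  · rintro ⟨hy, hae, -, hB⟩
    refine ⟨(hy.isPrimitive hab hp).congr (fun _ _ => rfl) ?_, hB⟩
    rw [Measure.restrict_congr_set (Ioo_ae_eq_Icc (μ := volume) (a := a) (b := b))] at hae
    filter_upwards [hae] with t ht
    simp [← ht]
  · rintro ⟨h, hB⟩
    have hy := h.memSobolev hab hp hA hf
    refine ⟨hy, ?_, fun hn t ht => ?_, hB⟩
    · rw [Measure.restrict_congr_set (Ioo_ae_eq_Icc (μ := volume) (a := a) (b := b))]
      filter_upwards [IsPrimitive.ae_derivWithin_eq hab h] with t ht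
      simp [ht]
    · obtain ⟨k, rfl⟩ : ∃ k, n = k + 1 := ⟨n - 1, by omega⟩
      rw [IsPrimitive.derivWithin_eqOn hab h (IsODESolution.rhs_mem hab hp hA hf
        (hy.of_succ hab hp) hy.continuousOn).continuousOn (Set.Ioo_subset_Icc_self ht)]
      simp

lemma IsODESolution.add_sum_smul {ι : Type*} (s : Finset ι)
    {A : ℝ → Matrix (Fin m) (Fin m) ℂ} {f y : ℝ → Fin m → ℂ} {Y : ι → ℝ → Fin m → ℂ}
    (h : IsODESolution (mulVecCLM m) a b A f y)
    (hY : ∀ i ∈ s, IsODESolution (mulVecCLM m) a b A 0 (Y i)) (c : ι → ℂ) :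
    IsODESolution (mulVecCLM m) a b A f (y + ∑ i ∈ s, c i • Y i) := by
  classical
  induction s using Finset.induction_on with
  | empty => simpa using h
  | insert i s hi ih =>
    rw [Finset.sum_insert hi, add_left_comm]
    have h1 := IsPrimitive.clm (hY i (by simp)) (c i • ContinuousLinearMap.id ℝ (Fin m → ℂ))
    refine (IsPrimitive.add h1 (ih fun j hj => hY j (by simp [hj]))).congr (fun _ _ => rfl)
      (Eventually.of_forall fun s => ?_)
    simp [Matrix.mulVec_add, Matrix.mulVec_smul]
    abel

lemma MemSobolev.complex_smul (hab : a < b) (hp : 1 ≤ p) {y : ℝ → Fin m → ℂ}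
    (hy : MemSobolev n p a b y) (c : ℂ) : MemSobolev n p a b (c • y) :=
  hy.clm hab hp (c • ContinuousLinearMap.id ℝ (Fin m → ℂ))

lemma MemSobolev.sum_smul (hab : a < b) (hp : 1 ≤ p) {ι : Type*} (s : Finset ι)
    {Y : ι → ℝ → Fin m → ℂ} (hY : ∀ i ∈ s, MemSobolev n p a b (Y i)) (c : ι → ℂ) :
    MemSobolev n p a b (∑ i ∈ s, c i • Y i) := by
  classical
  induction s using Finset.induction_on with
  | empty => exact memSobolev_const hab 0
  | insert i s hi ih =>
    rw [Finset.sum_insert hi]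
    exact ((hY i (by simp)).complex_smul hab hp (c i)).add hab hp (ih fun j hj => hY j (by simp [hj]))

section Operator

variable {ω : ℕ → ℝ → ℕ} {β : ℕ → ℕ → ℕ → ℝ → Matrix (Fin m) (Fin m) ℂ} {t : ℕ → ℕ → ℝ → ℝ} {ε : ℝ}
  {y z : ℝ → Fin m → ℂ}

lemma multipointOp_congr
    (ht : ∀ j ∈ Finset.range (r + 1), ∀ k ∈ Finset.Icc 1 (ω j ε), t j k ε ∈ Set.Icc a b)
    (h : Set.EqOn y z (Set.Icc a b)) :
    multipointOp n r a b ω β t ε y = multipointOp n r a b ω β t ε z := by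
  refine Finset.sum_congr rfl fun j hj => Finset.sum_congr rfl fun k hk =>
    Finset.sum_congr rfl fun l _ => ?_
  rw [iteratedDerivWithin_congr h (ht j hj k hk)]

lemma multipointOp_add (hab : a < b)
    (ht : ∀ j ∈ Finset.range (r + 1), ∀ k ∈ Finset.Icc 1 (ω j ε), t j k ε ∈ Set.Icc a b)
    (hy : MemSobolev (n + 1) p a b y) (hz : MemSobolev (n + 1) p a b z) :
    multipointOp (n + 1) r a b ω β t ε (y + z) =
      multipointOp (n + 1) r a b ω β t ε y + multipointOp (n + 1) r a b ω β t ε z := by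
  simp only [multipointOp, ← Finset.sum_add_distrib]
  refine Finset.sum_congr rfl fun j hj => Finset.sum_congr rfl fun k hk =>
    Finset.sum_congr rfl fun l hl => ?_
  rw [hy.iteratedDerivWithin_add hab hz (Nat.lt_succ_iff.1 (Finset.mem_range.1 hl)) (ht j hj k hk),
    Matrix.mulVec_add]

lemma multipointOp_smul (hab : a < b)
    (ht : ∀ j ∈ Finset.range (r + 1), ∀ k ∈ Finset.Icc 1 (ω j ε), t j k ε ∈ Set.Icc a b)
    (hy : MemSobolev (n + 1) p a b y) (c : ℂ) :
    multipointOp (n + 1) r a b ω β t ε (c • y) = c • multipointOp (n + 1) r a b ω β t ε y := by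
  simp only [multipointOp, Finset.smul_sum]
  refine Finset.sum_congr rfl fun j hj => Finset.sum_congr rfl fun k hk =>
    Finset.sum_congr rfl fun l hl => ?_
  rw [iteratedDerivWithin_const_smul (ht j hj k hk) (uniqueDiffOn_Icc hab) c
    ((hy.1.of_le (by exact_mod_cast Nat.lt_succ_iff.1 (Finset.mem_range.1 hl))) _ (ht j hj k hk)),
    Matrix.mulVec_smul]

lemma multipointOp_add_sum_smul (hab : a < b) (hp : 1 ≤ p)
    (ht : ∀ j ∈ Finset.range (r + 1), ∀ k ∈ Finset.Icc 1 (ω j ε), t j k ε ∈ Set.Icc a b)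
    (hy : MemSobolev (n + 1) p a b y) {ι : Type*} (s : Finset ι) {Y : ι → ℝ → Fin m → ℂ}
    (hY : ∀ i ∈ s, MemSobolev (n + 1) p a b (Y i)) (c : ι → ℂ) :
    multipointOp (n + 1) r a b ω β t ε (y + ∑ i ∈ s, c i • Y i) =
      multipointOp (n + 1) r a b ω β t ε y +
        ∑ i ∈ s, c i • multipointOp (n + 1) r a b ω β t ε (Y i) := by
  classical
  induction s using Finset.induction_on with
  | empty => simp
  | insert i s hi ih =>
    have hY' : ∀ j ∈ s, MemSobolev (n + 1) p a b (Y j) := fun j hj => hY j (by simp [hj])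
    rw [Finset.sum_insert hi, Finset.sum_insert hi, add_left_comm,
      multipointOp_add hab ht ((hY i (by simp)).complex_smul hab hp (c i))
        (hy.add hab hp (MemSobolev.sum_smul hab hp s hY' c)),
      multipointOp_smul hab ht (hY i (by simp)), ih hY', add_left_comm]

end Operator

end BoundaryValueProblem

/-! ### Fundamental systems and the characteristic matrix -/

section CharacteristicMatrix

variable {m n : ℕ} {p : ℝ≥0∞} {a b : ℝ}

lemma sobolevNorm_fun_zero {E : Type*} [NormedAddCommGroup E] [NormedSpace ℝ E] :
    sobolevNorm n p a b (0 : ℝ → E) = 0 := by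
  have h : ∀ k, iteratedDerivWithin k (0 : ℝ → E) (Set.Icc a b) = 0 := fun k =>
    funext fun _ => iteratedDerivWithin_const_zero
  simp [sobolevNorm_eq_sum, h]

/-- The functions `Y i` form the columns of the matrix solution of `Y' + A Y = 0`, `Y(a) = 1`. -/
def IsFundamentalSystem (a b : ℝ) (A : ℝ → Matrix (Fin m) (Fin m) ℂ)
    (Y : Fin m → ℝ → Fin m → ℂ) : Prop :=
  ∀ i, Y i a = Pi.single i 1 ∧ IsODESolution (mulVecCLM m) a b A 0 (Y i)

/-- The matrix whose columns are the values of the boundary operator on the functions `Y i`. -/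
def characteristicMatrix (B : (ℝ → Fin m → ℂ) → Fin m → ℂ) (Y : Fin m → ℝ → Fin m → ℂ) :
    Matrix (Fin m) (Fin m) ℂ :=
  Matrix.of fun k i => B (Y i) k

lemma characteristicMatrix_mulVec (B : (ℝ → Fin m → ℂ) → Fin m → ℂ) (Y : Fin m → ℝ → Fin m → ℂ)
    (c : Fin m → ℂ) : characteristicMatrix B Y *ᵥ c = ∑ i, c i • B (Y i) := by
  ext k
  simp [characteristicMatrix, Matrix.mulVec, dotProduct, mul_comm]

lemma exists_isFundamentalSystem (hab : a < b) (hp : 1 ≤ p)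
    {A : ℝ → Matrix (Fin m) (Fin m) ℂ} (hA : MemSobolev n p a b A) : ∃ Y, IsFundamentalSystem a b A Y := by
  choose Y hY using fun i : Fin m => exists_isODESolution (L := mulVecCLM m) hab
    (hA.integrableOn hp)
    (f := 0) integrableOn_zero (Pi.single i 1)
  exact ⟨Y, hY⟩

lemma IsFundamentalSystem.sum_smul_apply_left {A : ℝ → Matrix (Fin m) (Fin m) ℂ}
    {Y : Fin m → ℝ → Fin m → ℂ} (hY : IsFundamentalSystem a b A Y) (c : Fin m → ℂ) :
    (∑ i, c i • Y i) a = c := by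
  ext k
  simp [Finset.sum_apply, (hY _).1, Pi.single_apply]

/-- Every solution is a particular solution plus a combination of the fundamental system. -/
lemma IsFundamentalSystem.eqOn_add_sum (hab : a < b) (hp : 1 ≤ p)
    {A : ℝ → Matrix (Fin m) (Fin m) ℂ} (hA : MemSobolev n p a b A) {Y : Fin m → ℝ → Fin m → ℂ}
    (hY : IsFundamentalSystem a b A Y) {f y z : ℝ → Fin m → ℂ}
    (hy : IsODESolution (mulVecCLM m) a b A f y) (hya : y a = 0)
    (hz : IsODESolution (mulVecCLM m) a b A f z) :
    Set.EqOn z (y + ∑ i, z a i • Y i) (Set.Icc a b) := by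
  refine hz.eqOn hab (hA.integrableOn hp) (hy.add_sum_smul Finset.univ (fun i _ => (hY i).2) (z a)) ?_
  rw [Pi.add_apply, hya, hY.sum_smul_apply_left, zero_add]

end CharacteristicMatrix

theorem theorem6 (m n r : ℕ) (hn : 1 ≤ n) (p : ℝ≥0∞) (hp1 : 1 ≤ p) (hp : p ≠ ∞)
    (a b : ℝ) (hab : a < b) (ε₀ : ℝ) (hε₀ : 0 < ε₀)
    (A : ℝ → ℝ → Matrix (Fin m) (Fin m) ℂ)
    (hA : ∀ ε ∈ Set.Ico 0 ε₀, MemSobolev (n - 1) p a b (A ε))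
    (ω : ℕ → ℝ → ℕ) (β : ℕ → ℕ → ℕ → ℝ → Matrix (Fin m) (Fin m) ℂ)
    (t : ℕ → ℕ → ℝ → ℝ)
    (ht : ∀ ε ∈ Set.Ico 0 ε₀, ∀ j ∈ Finset.range (r + 1), ∀ k ∈ Finset.Icc 1 (ω j ε),
      t j k ε ∈ Set.Icc a b)
    (β₀ : ℕ → ℕ → Matrix (Fin m) (Fin m) ℂ) (t₀ : ℕ → ℝ)
    (ht₀ : ∀ j ∈ Finset.Icc 1 r, t₀ j ∈ Set.Icc a b)
    (hB₀ : ∀ y : ℝ → Fin m → ℂ, MemSobolev n p a b y →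
      multipointOp n r a b ω β t 0 y = limitMultipointOp n r a b β₀ t₀ y)
    (hα : CondAlpha r ω t t₀) (hβ : CondBeta n r ω β β₀)
    (hγp : CondGammaP n r p ω β t t₀) (hγ' : CondGamma' n r ω β t t₀)
    (hδ : CondDelta n ω β) :
    CondII n p a b (multipointOp n r a b ω β t) ∧
    (CondZero n p a b A (multipointOp n r a b ω β t) → CondI n p a b A →
      SolutionContinuousAtZero n p a b ε₀ A (multipointOp n r a b ω β t)) := by
  obtain ⟨n, rfl⟩ : ∃ N, n = N + 1 := ⟨n - 1, by omega⟩
  simp only [CondI, SolutionContinuousAtZero, Nat.add_sub_cancel] at hA ⊢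
  have hIoo : ∀ {δ : ℝ}, 0 < δ → ∀ᶠ ε in 𝓝[>] (0 : ℝ), ε ∈ Set.Ico 0 δ := fun hδ =>
    mem_of_superset (Ioo_mem_nhdsGT hδ) Set.Ioo_subset_Ico_self
  have h0 : (0 : ℝ) ∈ Set.Ico 0 ε₀ := ⟨le_rfl, hε₀⟩
  set B := multipointOp (n + 1) r a b ω β t with hBdef
  -- Convergence along varying arguments is used three times: for constant families (II), for the
  -- fundamental system, and for the particular solutions.
  have hB : ∀ {Y : ℝ → ℝ → Fin m → ℂ},
      (∀ᶠ ε in 𝓝[>] (0 : ℝ), MemSobolev (n + 1) p a b (Y ε)) → MemSobolev (n + 1) p a b (Y 0) →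
      Tendsto (fun ε => sobolevNorm (n + 1) p a b (Y ε - Y 0)) (𝓝[>] (0 : ℝ)) (𝓝 0) →
      Tendsto (fun ε => B ε (Y ε)) (𝓝[>] (0 : ℝ)) (𝓝 (B 0 (Y 0))) := by
    intro Y hY hY0 h
    rw [hB₀ _ hY0]
    exact tendsto_multipointOp hp1 hp hab ((hIoo hε₀).mono ht) ht₀ hα hβ hγp hγ' hδ hY hY0 h
  refine ⟨fun y hy => ?_, fun hzero hI => ?_⟩
  · refine hB (Y := fun _ => y) (Eventually.of_forall fun _ => hy) hy ?_
    simp only [sub_self, sobolevNorm_fun_zero, tendsto_const_nhds]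
  have hAev := (hIoo hε₀).mono hA
  have hex : ∀ ε, ∃ Y, ε ∈ Set.Ico 0 ε₀ → IsFundamentalSystem a b (A ε) Y := fun ε => by
    by_cases hε : ε ∈ Set.Ico 0 ε₀
    · obtain ⟨Y, hY⟩ := exists_isFundamentalSystem hab hp1 (hA ε hε)
      exact ⟨Y, fun _ => hY⟩
    · exact ⟨0, fun h => absurd h hε⟩
  choose Y hY using hex
  have h0W : MemSobolev n p a b (0 : ℝ → Fin m → ℂ) := memSobolev_const hab 0
  have hYW : ∀ ε ∈ Set.Ico 0 ε₀, ∀ i, MemSobolev (n + 1) p a b (Y ε i) := fun ε hε i =>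
    ((hY ε hε) i).2.memSobolev hab hp1 (hA ε hε) h0W
  have hcomb : ∀ ε ∈ Set.Ico 0 ε₀, ∀ y, MemSobolev (n + 1) p a b y → ∀ c : Fin m → ℂ,
      B ε (y + ∑ i, c i • Y ε i) = B ε y + characteristicMatrix (B ε) (Y ε) *ᵥ c := by
    intro ε hε y hy c
    rw [characteristicMatrix_mulVec]
    exact multipointOp_add_sum_smul hab hp1 (ht ε hε) hy _ (fun i _ => hYW ε hε i) c
  have hBz : ∀ ε ∈ Set.Ico 0 ε₀, ∀ f y z : ℝ → Fin m → ℂ, MemSobolev n p a b f →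
      IsODESolution (mulVecCLM m) a b (A ε) f y → y a = 0 →
      IsODESolution (mulVecCLM m) a b (A ε) f z →
      B ε z = B ε y + characteristicMatrix (B ε) (Y ε) *ᵥ z a := by
    intro ε hε f y z hf hy hya hz
    rw [← hcomb ε hε y (hy.memSobolev hab hp1 (hA ε hε) hf)]
    exact multipointOp_congr (ht ε hε) ((hY ε hε).eqOn_add_sum hab hp1 (hA ε hε) hy hya hz)
  have hinv : ∀ {M : Matrix (Fin m) (Fin m) ℂ} {c d e : Fin m → ℂ}, IsUnit M.det →
      e = d + M *ᵥ c → c = M⁻¹ *ᵥ (e - d) := fun hM h => by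
    rw [h, add_sub_cancel_left, Matrix.mulVec_mulVec, Matrix.nonsing_inv_mul _ hM,
      Matrix.one_mulVec]
  -- A kernel vector `v` of the matrix would give a solution of the limiting homogeneous problem
  -- with value `v` at `a`, which (0) forces to vanish.
  have hdet0 : IsUnit (characteristicMatrix (B 0) (Y 0)).det := by
    rw [isUnit_iff_ne_zero]
    intro hd
    obtain ⟨v, hv, hMv⟩ := Matrix.exists_mulVec_eq_zero_iff.2 hd
    have hz0 : IsODESolution (mulVecCLM m) a b (A 0) 0 0 := by
      refine ⟨?_, fun t _ => ?_⟩ <;> simp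
    have hs := hz0.add_sum_smul Finset.univ (fun i _ => (hY 0 h0 i).2) v
    have hBs := hBz 0 h0 0 0 _ h0W hz0 rfl hs
    have hB00 : B 0 0 = 0 := by
      have h1 := multipointOp_smul (n := n) (r := r) (p := p) (β := β) hab (ht 0 h0)
        (y := 0) (memSobolev_const hab 0) 0
      simpa using h1
    have hsa : ((0 : ℝ → Fin m → ℂ) + ∑ i, v i • Y 0 i) a = v := by
      rw [zero_add, (hY 0 h0).sum_smul_apply_left]
    rw [hsa, hMv, hB00, add_zero] at hBs
    have h1 := hzero _ ((isBVPSolution_iff hab hp1 (hA 0 h0) h0W).2 ⟨hs, hBs⟩)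
      (Set.left_mem_Icc.2 hab.le)
    rw [hsa] at h1
    exact hv h1
  have hM : Tendsto (fun ε => characteristicMatrix (B ε) (Y ε)) (𝓝[>] (0 : ℝ))
      (𝓝 (characteristicMatrix (B 0) (Y 0))) := by
    refine Matrix.tendsto_of_tendsto_apply fun i => ?_
    refine hB (Y := fun ε => Y ε i) ((hIoo hε₀).mono fun ε hε => hYW ε hε i) (hYW 0 h0 i) ?_
    refine tendsto_sobolevNorm_sub_of_isODESolution (f := fun _ => 0) hab hp1 hAev (hA 0 h0) hI
      (Eventually.of_forall fun _ => h0W) h0W ?_ ((hIoo hε₀).mono fun ε hε => (hY ε hε i).2)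
      (hY 0 h0 i).2 ?_
    · simp only [sub_self, sobolevNorm_fun_zero, tendsto_const_nhds]
    · rw [(hY 0 h0 i).1]
      exact tendsto_const_nhds.congr' ((hIoo hε₀).mono fun ε hε => ((hY ε hε i).1).symm)
  have hunit0 : IsUnit (characteristicMatrix (B 0) (Y 0)) :=
    (Matrix.isUnit_iff_isUnit_det _).2 hdet0
  have hunit : ∀ᶠ ε in 𝓝[>] (0 : ℝ), IsUnit (characteristicMatrix (B ε) (Y ε)) :=
    hM.eventually (Units.isOpen.mem_nhds hunit0)
  obtain ⟨δ, hδ0, hδu⟩ := mem_nhdsGT_iff_exists_Ioo_subset.1 hunit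
  -- Halving `ε₀` gives the strict inequality. Since `δ` controls only positive `ε`, the value `ε =
  -- 0` is covered separately by `hdet0`.
  have hε₁ : min δ (ε₀ / 2) < ε₀ := (min_le_right _ _).trans_lt (half_lt_self hε₀)
  have hε₁' : 0 < min δ (ε₀ / 2) := lt_min hδ0 (half_pos hε₀)
  have hsub : ∀ ε ∈ Set.Ico 0 (min δ (ε₀ / 2)), ε ∈ Set.Ico 0 ε₀ := fun ε hε =>
    ⟨hε.1, hε.2.trans hε₁⟩
  have hdet : ∀ ε ∈ Set.Ico 0 (min δ (ε₀ / 2)), IsUnit (characteristicMatrix (B ε) (Y ε)).det := by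
    intro ε hε
    rcases hε.1.eq_or_lt with h | h
    · rw [← h]; exact hdet0
    · exact (Matrix.isUnit_iff_isUnit_det _).1 (hδu ⟨h, hε.2.trans_le (min_le_left _ _)⟩)
  refine ⟨min δ (ε₀ / 2), hε₁', hε₁, fun ε hε f c hf => ?_, fun f c hf hff hc y hy => ?_⟩
  · have hε0 := hsub ε hε
    obtain ⟨yp, hya, hyp⟩ := exists_isODESolution (L := mulVecCLM m) hab ((hA ε hε0).integrableOn hp1)
      (hf.integrableOn hp1) 0
    set M := characteristicMatrix (B ε) (Y ε)
    have hys := hyp.add_sum_smul Finset.univ (fun i _ => (hY ε hε0 i).2) (M⁻¹ *ᵥ (c - B ε yp))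
    have hBy : B ε (yp + ∑ i, (M⁻¹ *ᵥ (c - B ε yp)) i • Y ε i) = c := by
      rw [hcomb ε hε0 yp (hyp.memSobolev hab hp1 (hA ε hε0) hf), Matrix.mulVec_mulVec,
        Matrix.mul_nonsing_inv _ (hdet ε hε), Matrix.one_mulVec, add_sub_cancel]
    refine ⟨_, (isBVPSolution_iff hab hp1 (hA ε hε0) hf).2 ⟨hys, hBy⟩, fun z hz => ?_⟩
    obtain ⟨hz1, hz2⟩ := (isBVPSolution_iff hab hp1 (hA ε hε0) hf).1 hz
    refine hz1.eqOn hab ((hA ε hε0).integrableOn hp1) hys ?_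
    rw [hinv (hdet ε hε) (hBz ε hε0 f yp z hf hyp hya hz1), hz2, Pi.add_apply, hya,
      (hY ε hε0).sum_smul_apply_left, zero_add]
  · have hy' : ∀ ε ∈ Set.Ico 0 (min δ (ε₀ / 2)),
        IsODESolution (mulVecCLM m) a b (A ε) (f ε) (y ε) ∧ B ε (y ε) = c ε := fun ε hε =>
      (isBVPSolution_iff hab hp1 (hA ε (hsub ε hε)) (hf ε (hsub ε hε))).1 (hy ε hε)
    have hexp : ∀ ε, ∃ u, ε ∈ Set.Ico 0 ε₀ →
        u a = 0 ∧ IsODESolution (mulVecCLM m) a b (A ε) (f ε) u := fun ε => by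
      by_cases hε : ε ∈ Set.Ico 0 ε₀
      · obtain ⟨u, hu⟩ := exists_isODESolution (L := mulVecCLM m) hab ((hA ε hε).integrableOn hp1)
          ((hf ε hε).integrableOn hp1) 0
        exact ⟨u, fun _ => hu⟩
      · exact ⟨0, fun h => absurd h hε⟩
    choose u hu using hexp
    have hfev := (hIoo hε₀).mono hf
    have hucont : Tendsto (fun ε => B ε (u ε)) (𝓝[>] (0 : ℝ)) (𝓝 (B 0 (u 0))) := by
      refine hB ((hIoo hε₀).mono fun ε hε => (hu ε hε).2.memSobolev hab hp1 (hA ε hε) (hf ε hε))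
        ((hu 0 h0).2.memSobolev hab hp1 (hA 0 h0) (hf 0 h0)) ?_
      refine tendsto_sobolevNorm_sub_of_isODESolution hab hp1 hAev (hA 0 h0) hI hfev (hf 0 h0) hff
        ((hIoo hε₀).mono fun ε hε => (hu ε hε).2) (hu 0 h0).2 ?_
      rw [(hu 0 h0).1]
      exact tendsto_const_nhds.congr' ((hIoo hε₀).mono fun ε hε => ((hu ε hε).1).symm)
    -- Solving the boundary condition for the initial value; its right-hand side converges, so
    -- continuity of the initial value problem finishes the proof.
    have hya : ∀ ε ∈ Set.Ico 0 (min δ (ε₀ / 2)),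
        y ε a = (characteristicMatrix (B ε) (Y ε))⁻¹ *ᵥ (c ε - B ε (u ε)) := fun ε hε => by
      have hε0 := hsub ε hε
      rw [← (hy' ε hε).2]
      exact hinv (hdet ε hε)
        (hBz ε hε0 _ _ _ (hf ε hε0) (hu ε hε0).2 (hu ε hε0).1 (hy' ε hε).1)
    have h0' : (0 : ℝ) ∈ Set.Ico 0 (min δ (ε₀ / 2)) := ⟨le_rfl, hε₁'⟩
    refine tendsto_sobolevNorm_sub_of_isODESolution hab hp1 hAev (hA 0 h0) hI hfev (hf 0 h0) hff
      ((hIoo hε₁').mono fun ε hε => (hy' ε hε).1) (hy' 0 h0').1 ?_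
    rw [hya 0 h0']
    exact (tendsto_inv_mulVec hM hunit0 (hc.sub hucont)).congr'
      ((hIoo hε₁').mono fun ε hε => (hya ε hε).symm)
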